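/- A bound is an ordinal of the form $\omega^\beta$ or $\omega^\beta+1$ with $\beta\ge 0$; it is proper if it is of one of these forms with $\beta\ge 1$. For a proper bound $\alpha$, let $\mathrm{flt}\,\alpha$ be the rank of $\alpha$ in the poset of all proper bounds less than or equal to $\alpha$; for the two bounds $\alpha\in\{1,2\}$ that are not proper, let $\mathrm{flt}\,\alpha=0$. For an ordinal $\xi$, let $\xi'=\xi+1$ if $\xi=\delta+n$ for some $n\in\mathbb N$ and some critical ordinal $\delta$ (that is, $\omega^\delta=\delta$), and $\xi'=\xi$ otherwise. Let $\oplus$ be the natural (Hessenberg) sum of ordinals. The rank of an element $x$ of a well-founded poset is the least ordinal strictly larger than the ranks of all elements $y<x$. For a Noetherian space $Z$, the stature $\|Z\|$ is the rank of $Z$ in the lattice of closed subsets of $Z$, ordered by inclusion. If $Z$ is non-empty, its reduced sobrification rank $\mathrm{rsob}\,Z$ is the maximum of the ranks of the (finitely many) maximal irreducible closed subsets of $Z$ in the poset of irreducible closed subsets of $Z$, ordered by inclusion. A transfinite word on $X$ is a map $w$ from an ordinal $|w|$, its length, to $X$; for a subset $F$ of $X$, $F^{<\alpha}$ is the set of words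 of length strictly less than $\alpha$ with all letters in $F$. For a topological space $X$, the set $X^{<\alpha}$ is given the regular subword topology, the coarsest topology for which all the sets $(F_1^{<\alpha_1}F_2^{<\alpha_2}\cdots F_n^{<\alpha_n})\cap X^{<\alpha}$ are closed, where $n\in\mathbb N$, $F_1,\dots,F_n$ are closed subsets of $X$, $\alpha_1,\dots,\alpha_n$ are ordinals, and juxtaposition is elementwise concatenation (the empty product being the set that consists of the empty word). **Proposition.** For every Noetherian space $X$ and every bound $\alpha$, the space $X^{<\alpha}$ is Noetherian, and $$\mathrm{rsob}\,X^{<\alpha}\le\omega^{(\|X\|\oplus\mathrm{flt}\,\alpha)'},\qquad \|X^{<\alpha}\|\le\omega^{\omega^{(\|X\|\oplus\mathrm{flt}\,\alpha)'}}.$$ -/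

import Mathlib

universe u v

noncomputable section

open TopologicalSpace

/-! ### Ranks -/

/-- The rank (height) of an element of a well-founded order: the least ordinal strictly larger
than the ranks of all smaller elements. -/
def wfRank {P : Type u} [Preorder P] [WellFoundedLT P] (x : P) : Ordinal.{u} :=
  IsWellFounded.rank (· < ·) x

/-- The irreducible closed subsets of a Noetherian space are well-founded under inclusion. -/
instance instWellFoundedLTIrreducibleCloseds (Z : Type u) [TopologicalSpace Z]
    [NoetherianSpace Z] : WellFoundedLT (IrreducibleCloseds Z) where
  wf := Subrelation.wf (r := InvImage (· < ·) fun C : IrreducibleCloseds Z =>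
      (⟨C, C.isClosed⟩ : Closeds Z)) (fun h => h) (InvImage.wf _ wellFounded_lt)

/-- The stature of a Noetherian space: the rank of the whole space in the lattice of closed
subsets. -/
def stature (Z : Type u) [TopologicalSpace Z] [NoetherianSpace Z] : Ordinal.{u} :=
  wfRank (⊤ : Closeds Z)

/-- The reduced sobrification rank of a (non-empty) Noetherian space: the largest of the ranks, in
the poset of irreducible closed subsets (the sobrification), of the maximal irreducible closed
subsets. There are finitely many of those and at least one, so the supremum is a maximum. -/
def rsob (Z : Type u) [TopologicalSpace Z] [NoetherianSpace Z] : Ordinal.{u} :=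
  ⨆ C : {C : IrreducibleCloseds Z // IsMax C}, wfRank C.1

/-! ### Ordinals -/

namespace Ordinal

/-- The natural (Hessenberg) sum: the coefficients of the Cantor normal forms in base `ω` are added
exponent by exponent, i.e. the two decreasing lists of powers of `ω` are merged. -/
def naturalSum (a b : Ordinal.{u}) : Ordinal.{u} :=
  CNF.eval omega0 (CNF.coeff omega0 a + CNF.coeff omega0 b)

/-- Critical ordinals, i.e. epsilon numbers. -/
def IsCritical (d : Ordinal.{u}) : Prop :=
  omega0 ^ d = d

open Classical in
/-- The adjustment `a'` of an ordinal: `a + 1` if `a` is a critical ordinal plus a natural number,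
and `a` otherwise. -/
def adjust (a : Ordinal.{u}) : Ordinal.{u} :=
  if ∃ d : Ordinal.{u}, IsCritical d ∧ ∃ n : ℕ, a = d + n then a + 1 else a

/-- Bounds: ordinals of the form `ω ^ b` or `ω ^ b + 1`. -/
def IsBound (a : Ordinal.{v}) : Prop :=
  ∃ b : Ordinal.{v}, a = omega0 ^ b ∨ a = omega0 ^ b + 1

/-- Proper bounds: ordinals of the form `ω ^ b` or `ω ^ b + 1` with `b ≥ 1`. -/
def IsProperBound (a : Ordinal.{v}) : Prop :=
  ∃ b : Ordinal.{v}, 1 ≤ b ∧ (a = omega0 ^ b ∨ a = omega0 ^ b + 1)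

open Classical in
/-- The rank of a proper bound `a` in the poset of all proper bounds less than or equal to `a`.
The two bounds `1` and `2` that are not proper get the value `0`. -/
def flt (a : Ordinal.{v}) : Ordinal.{v + 1} :=
  if h : IsProperBound a then
    wfRank (⟨a, h, le_rfl⟩ : {g : Ordinal.{v} // IsProperBound g ∧ g ≤ a})
  else 0

end Ordinal

/-! ### Transfinite words -/

/-- A transfinite word on `X`: a map to `X` from (the set of ordinals below) an ordinal. -/
structure TransfiniteWord (X : Type u) : Type (max u (v + 1)) where
  length : Ordinal.{v}
  letter : Set.Iio length → X

namespace TransfiniteWord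

variable {X : Type u}

/-- The empty word. -/
def nil : TransfiniteWord.{u, v} X where
  length := 0
  letter i := absurd i.2 (not_lt_bot (α := Ordinal.{v}))

/-- Concatenation of words. -/
def append (w w' : TransfiniteWord.{u, v} X) : TransfiniteWord.{u, v} X where
  length := w.length + w'.length
  letter i :=
    if h : i.1 < w.length then w.letter ⟨i.1, h⟩
    else w'.letter ⟨i.1 - w.length, (Ordinal.sub_lt_of_le (not_lt.1 h)).2 i.2⟩

/-- Concatenation of sets of words. -/
def setAppend (A B : Set (TransfiniteWord.{u, v} X)) : Set (TransfiniteWord.{u, v} X) :=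
  Set.image2 append A B

/-- `F^{<a}`, the set of words of length less than `a` with all letters in `F`. -/
def powLT (F : Set X) (a : Ordinal.{v}) : Set (TransfiniteWord.{u, v} X) :=
  {w | w.length < a ∧ ∀ i, w.letter i ∈ F}

/-- `F₁^{<a₁} F₂^{<a₂} ⋯ Fₙ^{<aₙ}`, for closed subsets `Fᵢ` and ordinals `aᵢ`. -/
def closedProduct [TopologicalSpace X] (L : List (Closeds X × Ordinal.{v})) :
    Set (TransfiniteWord.{u, v} X) :=
  L.foldr (fun p A => setAppend (powLT (p.1 : Set X) p.2) A) {nil}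

/-- The regular subword topology on a set `Y` of transfinite words: the coarsest topology that
makes all the sets `(F₁^{<a₁} ⋯ Fₙ^{<aₙ}) ∩ Y` closed. -/
abbrev regularSubwordTopology [TopologicalSpace X] (Y : Set (TransfiniteWord.{u, v} X)) :
    TopologicalSpace Y :=
  generateFrom {U | ∃ L : List (Closeds X × Ordinal.{v}), U = {w : Y | w.1 ∈ closedProduct L}ᶜ}

end TransfiniteWord

/-- `X^{<a}`, the set of words on `X` of length less than `a`. -/
def WordsLT (X : Type u) (a : Ordinal.{v}) : Type (max u (v + 1)) :=
  ↥(TransfiniteWord.powLT (Set.univ : Set X) a)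

instance instTopologicalSpaceWordsLT (X : Type u) [TopologicalSpace X] (a : Ordinal.{v}) :
    TopologicalSpace (WordsLT X a) :=
  TransfiniteWord.regularSubwordTopology (TransfiniteWord.powLT (Set.univ : Set X) a)

end

noncomputable section

open TopologicalSpace

/-! ### Ranks in well-founded orders -/

/-! Every closed set of words is a finite union of products of factors `F^{<a}`, with `a` a bound,
and every irreducible one is a single product. Both bounds come from a strictly monotone ordinal
weight on these products.

A factor `F^{<a}` with `a ≠ 2` weighs `ω ^ (rank F ⊕ flt a)'`; for `a = 2` it weighs `rank F`. A
product weighs the natural sum of its factors, and a set of words gets the least weight of a product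
describing it (`minWeight`). Powers of `ω` are closed under natural sums, so a product of factors
strictly smaller than `F^{<a}` weighs less than `F^{<a}`. The adjustment makes `x < ω ^ x'` strict,
which separates factors with `a = 2` from the others.

Monotonicity rests on an analysis of inclusions. Each factor `e` contains a generic word
(`exists_generic`): whatever can follow it inside a product `L` is constrained as if all of `e` had
been read. Hence, if a product `A` lies in `f L`, the list `A` splits as `D ++ E` with `D` inside
`f` and `E` inside `L` (`exists_eq_append_of_closedProduct_subset`). Weights are then compared
factor by factor (`exists_weight_le_weight`).

The descending weight makes the lattice of finite unions well-founded, so these unions account for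
all closed sets and the space is Noetherian. It bounds the ranks of irreducible closed sets, hence
`rsob`. The stature costs one more exponential (`stature_le_opow`): a closed set is a finite union
of irreducible ones, and the rank of a union is at most the natural sum of the ranks. -/

theorem wfRank_lt_wfRank {P : Type u} [Preorder P] [WellFoundedLT P] {x y : P} (h : x < y) :
    wfRank x < wfRank y :=
  IsWellFounded.rank_lt_of_rel h

theorem wfRank_le_iff {P : Type u} [Preorder P] [WellFoundedLT P] {x : P} {o : Ordinal.{u}} :
    wfRank x ≤ o ↔ ∀ y < x, wfRank y < o := by
  refine ⟨fun h y hy => (wfRank_lt_wfRank hy).trans_le h, fun h => ?_⟩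
  rw [wfRank, IsWellFounded.rank_eq]
  exact Ordinal.iSup_le fun y => Order.succ_le_of_lt (h y.1 y.2)

/-- The rank is the least strictly monotone ordinal-valued function. -/
theorem wfRank_le_of_strictMono {P : Type u} [Preorder P] [WellFoundedLT P]
    {f : P → Ordinal.{u}} (hf : StrictMono f) (x : P) : wfRank x ≤ f x := by
  induction x using WellFoundedLT.induction with
  | ind x ih => exact wfRank_le_iff.2 fun y hy => (ih y hy).trans_lt (hf hy)

namespace Ordinal

open CNF

/-! ### The natural sum -/

theorem coeff_omega0_lt (o e : Ordinal.{u}) : coeff ω o e < ω := by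
  by_cases h : e ∈ (CNF ω o).map Prod.fst
  · obtain ⟨⟨e, c⟩, hc, rfl⟩ := List.mem_map.1 h
    rw [coeff_of_mem_CNF hc]
    exact CNF.snd_lt one_lt_omega0 hc
  · rw [coeff_of_notMem_CNF h]
    exact omega0_pos

theorem coeff_add_coeff_lt (a b e : Ordinal.{u}) : (coeff ω a + coeff ω b) e < ω :=
  isPrincipal_add_omega0 (coeff_omega0_lt a e) (coeff_omega0_lt b e)

theorem coeff_naturalSum (a b : Ordinal.{u}) :
    coeff ω (naturalSum a b) = coeff ω a + coeff ω b :=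
  coeff_eval one_lt_omega0 (coeff_add_coeff_lt a b)

theorem add_comm_of_lt_omega0 {a b : Ordinal.{u}} (ha : a < ω) (hb : b < ω) :
    a + b = b + a := by
  obtain ⟨m, rfl⟩ := lt_omega0.1 ha
  obtain ⟨n, rfl⟩ := lt_omega0.1 hb
  exact_mod_cast Nat.add_comm m n

theorem naturalSum_comm (a b : Ordinal.{u}) : naturalSum a b = naturalSum b a := by
  rw [← coeff_inj (b := ω), coeff_naturalSum, coeff_naturalSum]
  ext e
  exact add_comm_of_lt_omega0 (coeff_omega0_lt a e) (coeff_omega0_lt b e)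

theorem naturalSum_assoc (a b c : Ordinal.{u}) :
    naturalSum (naturalSum a b) c = naturalSum a (naturalSum b c) := by
  rw [← coeff_inj (b := ω)]
  simp only [coeff_naturalSum, add_assoc]

theorem zero_naturalSum (a : Ordinal.{u}) : naturalSum 0 a = a := by
  simp [naturalSum]

theorem naturalSum_zero (a : Ordinal.{u}) : naturalSum a 0 = a := by
  simp [naturalSum]

/-- Cut both normal forms at exponent `e`: the parts above agree, the terms at `e` decide, and the
part of `f` below `e` stays under `ω ^ e`. -/
theorem eval_lt_eval {f g : Ordinal.{u} →₀ Ordinal.{u}} (hf : ∀ e, f e < ω) {e : Ordinal.{u}}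
    (he : f e < g e) (h : ∀ e', e < e' → f e' = g e') : eval ω f < eval ω g := by
  have key (k : Ordinal.{u} →₀ Ordinal.{u}) : eval ω k =
      eval ω (k.filter (e < ·)) + (ω ^ e * k e + eval ω (k.filter (· < e))) := by
    rw [← eval_single_add', ← eval_add]
    · congr 1
      ext x
      simp only [Finsupp.add_apply, Finsupp.filter_apply]
      rcases lt_trichotomy x e with hx | rfl | hx
      · simp [hx, hx.not_gt, Finsupp.single_eq_of_ne hx.ne]
      · simp
      · simp [hx, hx.not_gt, Finsupp.single_eq_of_ne hx.ne']
    · intro e₁ h₁ e₂ h₂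
      have h₁ : e < e₁ := by
        rw [Finsupp.support_filter, Finset.mem_filter] at h₁; exact h₁.2
      rcases Finset.mem_union.1 (Finsupp.support_add h₂) with h₂ | h₂
      · rw [Finset.mem_singleton.1 (Finsupp.support_single_subset h₂)]
        exact h₁.le
      · rw [Finsupp.support_filter, Finset.mem_filter] at h₂
        exact (h₂.2.trans h₁).le
    · intro e' h'
      rw [Finsupp.support_filter, Finset.mem_filter] at h'
      exact h'.2
  rw [key f, key g]
  have hfg : f.filter (e < ·) = g.filter (e < ·) := by
    ext x
    simp only [Finsupp.filter_apply]
    split_ifs with hx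
    · exact h x hx
    · rfl
  rw [hfg]
  refine add_lt_add_right ?_ _
  refine (opow_mul_add_lt_opow_mul ?_ he).trans_le le_self_add
  refine eval_lt (fun e' => ?_) fun e' h' => ?_
  · rw [Finsupp.filter_apply]
    split_ifs
    · exact hf e'
    · exact omega0_pos
  · rw [Finsupp.support_filter, Finset.mem_filter] at h'
    exact h'.2

/-- The largest exponent where the coefficients differ decides. This form makes strict monotonicity
of the natural sum immediate, since it adds coefficients. -/
theorem lt_iff_coeff_lt {a b : Ordinal.{u}} :
    a < b ↔ ∃ e, coeff ω a e < coeff ω b e ∧ ∀ e', e < e' → coeff ω a e' = coeff ω b e' := by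
  have mpr {a b : Ordinal.{u}} : (∃ e, coeff ω a e < coeff ω b e ∧
      ∀ e', e < e' → coeff ω a e' = coeff ω b e') → a < b := by
    rintro ⟨e, he, h⟩
    simpa using eval_lt_eval (coeff_omega0_lt a) he h
  refine ⟨fun hab => ?_, mpr⟩
  classical
  let s := ((coeff ω a).support ∪ (coeff ω b).support).filter
    fun e => coeff ω a e ≠ coeff ω b e
  have hs : s.Nonempty := by
    by_contra hs
    refine hab.ne ((coeff_inj (b := ω)).1 (Finsupp.ext fun e => ?_))
    by_contra he
    refine hs ⟨e, Finset.mem_filter.2 ⟨?_, he⟩⟩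
    simp only [Finset.mem_union, Finsupp.mem_support_iff]
    by_contra! h
    exact he (h.1.trans h.2.symm)
  have hmax (e') (h' : s.max' hs < e') : coeff ω a e' = coeff ω b e' := by
    by_contra he
    refine (s.le_max' e' (Finset.mem_filter.2 ⟨?_, he⟩)).not_gt h'
    simp only [Finset.mem_union, Finsupp.mem_support_iff]
    by_contra! h
    exact he (h.1.trans h.2.symm)
  rcases (Finset.mem_filter.1 (s.max'_mem hs)).2.lt_or_gt with h | h
  · exact ⟨_, h, hmax⟩
  · exact absurd hab (mpr ⟨_, h, fun e' h' => (hmax e' h').symm⟩).not_gt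

theorem naturalSum_lt_naturalSum_left {a b : Ordinal.{u}} (h : a < b) (c : Ordinal.{u}) :
    naturalSum c a < naturalSum c b := by
  rw [lt_iff_coeff_lt] at h ⊢
  obtain ⟨e, he, h⟩ := h
  simp only [coeff_naturalSum, Finsupp.add_apply]
  exact ⟨e, add_lt_add_right he _, fun e' h' => by rw [h e' h']⟩

theorem naturalSum_lt_naturalSum_right {a b : Ordinal.{u}} (h : a < b) (c : Ordinal.{u}) :
    naturalSum a c < naturalSum b c := by
  rw [naturalSum_comm a, naturalSum_comm b]
  exact naturalSum_lt_naturalSum_left h c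

theorem naturalSum_le_naturalSum {a b c d : Ordinal.{u}} (h : a ≤ b) (h' : c ≤ d) :
    naturalSum a c ≤ naturalSum b d := by
  have h₁ : naturalSum a c ≤ naturalSum b c :=
    (StrictMono.monotone (f := (naturalSum · c)) fun _ _ h => naturalSum_lt_naturalSum_right h c) h
  have h₂ : naturalSum b c ≤ naturalSum b d :=
    (StrictMono.monotone (f := naturalSum b) fun _ _ h => naturalSum_lt_naturalSum_left h b) h'
  exact h₁.trans h₂

theorem naturalSum_lt_of_lt_of_le {a b c d : Ordinal.{u}} (h : a < b) (h' : c ≤ d) :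
    naturalSum a c < naturalSum b d :=
  (naturalSum_lt_naturalSum_right h c).trans_le (naturalSum_le_naturalSum le_rfl h')

theorem naturalSum_lt_of_le_of_lt {a b c d : Ordinal.{u}} (h : a ≤ b) (h' : c < d) :
    naturalSum a c < naturalSum b d :=
  (naturalSum_lt_naturalSum_left h' a).trans_le (naturalSum_le_naturalSum h le_rfl)

theorem le_naturalSum_left (a b : Ordinal.{u}) : a ≤ naturalSum a b := by
  simpa [naturalSum_zero] using naturalSum_le_naturalSum (le_refl a) (zero_le (a := b))

theorem naturalSum_lt_opow {a b c : Ordinal.{u}} (ha : a < ω ^ c) (hb : b < ω ^ c) :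
    naturalSum a b < ω ^ c := by
  refine eval_lt (coeff_add_coeff_lt a b) fun e he => ?_
  by_contra! hce
  have h := opow_le_opow_right omega0_pos hce
  refine Finsupp.mem_support_iff.1 he ?_
  rw [Finsupp.add_apply, coeff_eq_zero_of_lt (ha.trans_le h), coeff_eq_zero_of_lt (hb.trans_le h),
    add_zero]

/-! ### The adjustment -/

theorem le_adjust (a : Ordinal.{u}) : a ≤ adjust a := by
  unfold adjust
  split_ifs
  · exact le_self_add
  · exact le_rfl

/-- The jump at `a` could only collide with `b = a + 1`, but then `b` is also critical plus a
natural number and jumps too. -/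
theorem adjust_strictMono : StrictMono adjust.{u} := by
  intro a b hab
  by_cases ha : ∃ d : Ordinal.{u}, IsCritical d ∧ ∃ n : ℕ, a = d + n
  · rw [adjust, if_pos ha]
    rcases (Order.add_one_le_of_lt hab).eq_or_lt with rfl | h
    · obtain ⟨d, hd, n, rfl⟩ := ha
      rw [adjust, if_pos ⟨d, hd, n + 1, by push_cast; rw [add_assoc]⟩]
      exact lt_add_one _
    · exact h.trans_le (le_adjust b)
  · rw [adjust, if_neg ha]
    exact hab.trans_le (le_adjust b)

/-- Always `a ≤ ω ^ a`, with equality exactly at critical ordinals, where the adjustment adds one.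
-/
theorem lt_opow_adjust (a : Ordinal.{u}) : a < ω ^ adjust a := by
  rcases (right_le_opow a one_lt_omega0).eq_or_lt with h | h
  · rw [adjust, if_pos ⟨a, h.symm, 0, by simp⟩]
    conv_lhs => rw [h]
    exact (opow_lt_opow_iff_right one_lt_omega0).2 (lt_add_one a)
  · exact h.trans_le (opow_le_opow_right omega0_pos (le_adjust a))

/-! ### Bounds -/

/-- The largest power of `ω` below a bound. -/
def core (a : Ordinal.{v}) : Ordinal.{v} :=
  ω ^ log ω a

theorem core_opow (b : Ordinal.{v}) : core (ω ^ b) = ω ^ b := by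
  rw [core, log_opow one_lt_omega0]

theorem core_opow_add_one (b : Ordinal.{v}) : core (ω ^ b + 1) = ω ^ b := by
  rcases eq_or_ne b 0 with rfl | hb
  · rw [core, log_eq_zero] 
    simpa [one_add_one_eq_two] using natCast_lt_omega0 2
  · have := log_opow_mul_add (b := ω) (u := b) (v := 1) (w := 1) one_lt_omega0 one_ne_zero
      (one_lt_opow.2 ⟨one_lt_omega0, hb⟩)
    rw [mul_one, log_one_right, add_zero] at this
    rw [core, this]

namespace IsBound

variable {a : Ordinal.{v}}

theorem core_le (h : IsBound a) : core a ≤ a := by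
  obtain ⟨b, rfl | rfl⟩ := h
  · rw [core_opow]
  · rw [core_opow_add_one]
    exact le_self_add

theorem pos (h : IsBound a) : 0 < a :=
  (opow_pos _ omega0_pos).trans_le h.core_le

/-- A bound exceeds its core by at most one, so a non-empty remainder `y` forces `x` below the core.
-/
theorem lt_core_of_add_lt (h : IsBound a) {x y : Ordinal.{v}} (hxy : x + y < a) (hy : 0 < y) :
    x < core a := by
  have hx : x < x + y := lt_add_of_pos_right x hy
  obtain ⟨b, rfl | rfl⟩ := h
  · rw [core_opow]
    exact hx.trans hxy
  · rw [core_opow_add_one]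
    exact hx.trans_le (Order.lt_add_one_iff.1 hxy)

theorem add_lt (h : IsBound a) {x y : Ordinal.{v}} (hx : x < core a) (hy : y < a) :
    x + y < a := by
  obtain ⟨b, rfl | rfl⟩ := h
  · rw [core_opow] at hx
    exact isPrincipal_add_omega0_opow b hx hy
  · rw [core_opow_add_one] at hx
    rw [Order.lt_add_one_iff] at hy ⊢
    rw [← add_omega0_opow hx]
    gcongr

theorem isProperBound (h : IsBound a) (h₁ : a ≠ 1) (h₂ : a ≠ 2) : IsProperBound a := by
  obtain ⟨b, hb⟩ := h
  refine ⟨b, Order.one_le_iff_pos.2 (pos_iff_ne_zero.2 ?_), hb⟩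
  rintro rfl
  rcases hb with rfl | rfl
  · simp at h₁
  · simp [one_add_one_eq_two] at h₂

theorem two_le (h : IsBound a) (h₁ : a ≠ 1) : 2 ≤ a := by
  rw [← one_add_one_eq_two]
  exact Order.add_one_le_of_lt (lt_of_le_of_ne (Order.one_le_iff_pos.2 h.pos) h₁.symm)

end IsBound

theorem flt_lt_flt {a b : Ordinal.{v}} (ha : IsProperBound a) (hb : IsProperBound b)
    (hab : a < b) : flt a < flt b := by
  rw [flt, dif_pos ha, flt, dif_pos hb]
  have hmono : StrictMono fun x : {g : Ordinal.{v} // IsProperBound g ∧ g ≤ a} =>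
      wfRank (⟨x.1, x.2.1, x.2.2.trans hab.le⟩ : {g : Ordinal.{v} // IsProperBound g ∧ g ≤ b}) :=
    fun x y h => wfRank_lt_wfRank h
  exact (wfRank_le_of_strictMono hmono _).trans_lt (wfRank_lt_wfRank hab)

end Ordinal

/-! ### Ranks in distributive lattices -/

/-- By distributivity, an element below `a ⊔ b` is a join of parts of `a` and `b`, one of them
strictly smaller. Stated for accessibility because it serves to prove well-foundedness. -/
theorem acc_lt_sup {L : Type*} [DistribLattice L] {a b : L} (ha : Acc (· < ·) a)
    (hb : Acc (· < ·) b) : Acc (· < ·) (a ⊔ b) := by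
  induction ha generalizing b with
  | intro a ha iha =>
    induction hb with
    | intro b hb ihb =>
      have hb' : Acc (· < ·) b := Acc.intro b hb
      refine Acc.intro _ fun c hc => ?_
      have hcab : c = (c ⊓ a) ⊔ (c ⊓ b) := by rw [← inf_sup_left, inf_eq_left.2 hc.le]
      rcases (inf_le_right : c ⊓ a ≤ a).eq_or_lt with h₁ | h₁
      · rcases (inf_le_right : c ⊓ b ≤ b).eq_or_lt with h₂ | h₂
        · rw [h₁, h₂] at hcab
          exact absurd hcab hc.ne
        · rw [hcab, h₁]
          exact ihb _ h₂
      · rw [hcab]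
        refine iha _ h₁ ?_
        rcases (inf_le_right : c ⊓ b ≤ b).eq_or_lt with h₂ | h₂
        · rwa [h₂]
        · exact hb _ h₂

theorem wfRank_sup_le {L : Type u} [DistribLattice L] [WellFoundedLT L] (a b : L) :
    wfRank (a ⊔ b) ≤ Ordinal.naturalSum (wfRank a) (wfRank b) := by
  induction a using WellFoundedLT.induction generalizing b with
  | ind a iha =>
    induction b using WellFoundedLT.induction with
    | ind b ihb =>
      refine wfRank_le_iff.2 fun c hc => ?_
      have hcab : c = (c ⊓ a) ⊔ (c ⊓ b) := by rw [← inf_sup_left, inf_eq_left.2 hc.le]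
      rcases (inf_le_right : c ⊓ a ≤ a).eq_or_lt with h₁ | h₁
      · rcases (inf_le_right : c ⊓ b ≤ b).eq_or_lt with h₂ | h₂
        · rw [h₁, h₂] at hcab
          exact absurd hcab hc.ne
        · rw [hcab, h₁]
          exact (ihb _ h₂).trans_lt
            (Ordinal.naturalSum_lt_naturalSum_left (wfRank_lt_wfRank h₂) _)
      · rw [hcab]
        refine (iha _ h₁ _).trans_lt (Ordinal.naturalSum_lt_of_lt_of_le (wfRank_lt_wfRank h₁) ?_)
        rcases (inf_le_right : c ⊓ b ≤ b).eq_or_lt with h₂ | h₂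
        · rw [h₂]
        · exact (wfRank_lt_wfRank h₂).le

theorem wfRank_bot {L : Type u} [Preorder L] [OrderBot L] [WellFoundedLT L] :
    wfRank (⊥ : L) = 0 :=
  nonpos_iff_eq_zero.1 (wfRank_le_iff.2 fun _ hy => absurd hy not_lt_bot)

/-! ### Noetherian spaces -/

section Noetherian

variable {Z : Type u} [TopologicalSpace Z] [NoetherianSpace Z]

theorem wfRank_lt_opow_of_irreducible {o : Ordinal.{u}} (F : Closeds Z)
    (h : ∀ C : IrreducibleCloseds Z, (C : Set Z) ⊆ F →
      wfRank (⟨C, C.isClosed⟩ : Closeds Z) < Ordinal.omega0 ^ o) :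
    wfRank F < Ordinal.omega0 ^ o := by
  obtain ⟨S, hfin, hirr, rfl⟩ := NoetherianSpace.exists_finite_set_closeds_irreducible F
  have hle : ∀ C ∈ S, C ≤ sSup S := fun C hC => le_sSup hC
  have hC : ∀ C ∈ S, wfRank C < Ordinal.omega0 ^ o := fun C hC =>
    h ⟨C, hirr C hC, C.isClosed⟩ (hle C hC)
  clear h hle hirr
  induction S, hfin using Set.Finite.induction_on with
  | empty =>
    rw [sSup_empty, wfRank_bot]
    exact Ordinal.opow_pos _ Ordinal.omega0_pos
  | insert _ _ ih =>
    rw [sSup_insert]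
    exact (wfRank_sup_le _ _).trans_lt (Ordinal.naturalSum_lt_opow (hC _ (Set.mem_insert _ _))
      (ih fun C h => hC C (Set.mem_insert_of_mem _ h)))

/-- By induction an irreducible `C` has rank at most `ω ^ f C` among all closed sets: a proper
closed subset has finitely many irreducible components, each of rank below `ω ^ f C`, and this power
is closed under natural sums. The whole space need not be irreducible. -/
theorem stature_le_opow {f : IrreducibleCloseds Z → Ordinal.{u}} (hf : StrictMono f)
    {o : Ordinal.{u}} (ho : ∀ C : IrreducibleCloseds Z, (C : Set Z) ≠ Set.univ → f C < o) :
    stature Z ≤ Ordinal.omega0 ^ o := by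
  have key (C : IrreducibleCloseds Z) :
      wfRank (⟨C, C.isClosed⟩ : Closeds Z) ≤ Ordinal.omega0 ^ f C := by
    induction C using WellFoundedLT.induction with
    | ind C ih =>
      refine wfRank_le_iff.2 fun F hF => wfRank_lt_opow_of_irreducible F fun D hD => ?_
      have hDC : D < C := lt_of_le_of_lt (a := (D : Set Z)) hD hF
      exact (ih D hDC).trans_lt
        ((Ordinal.opow_lt_opow_iff_right Ordinal.one_lt_omega0).2 (hf hDC))
  refine wfRank_le_iff.2 fun F hF => wfRank_lt_opow_of_irreducible F fun D hD => ?_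
  refine (key D).trans_lt ((Ordinal.opow_lt_opow_iff_right Ordinal.one_lt_omega0).2 (ho D ?_))
  intro h
  exact hF.ne (SetLike.coe_injective (Set.univ_subset_iff.1 (h ▸ hD)))

end Noetherian

namespace TransfiniteWord

variable {X : Type u}

/-! ### Concatenation -/

theorem ext_letter {w w' : TransfiniteWord.{u, v} X} (h : w.length = w'.length)
    (h' : ∀ i (hi : i < w.length) (hi' : i < w'.length), w.letter ⟨i, hi⟩ = w'.letter ⟨i, hi'⟩) :
    w = w' := by
  obtain ⟨l, f⟩ := w
  obtain ⟨l', f'⟩ := w'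
  obtain rfl : l = l' := h
  congr
  ext ⟨i, hi⟩
  exact h' i hi hi

theorem eq_nil_of_length {w : TransfiniteWord.{u, v} X} (h : w.length = 0) : w = nil :=
  ext_letter h fun i hi _ => absurd hi (by rw [h]; exact not_lt_bot)

@[simp]
theorem length_nil : (nil : TransfiniteWord.{u, v} X).length = 0 :=
  rfl

@[simp]
theorem length_append (w w' : TransfiniteWord.{u, v} X) :
    (w.append w').length = w.length + w'.length :=
  rfl

theorem append_letter_of_lt (w w' : TransfiniteWord.{u, v} X) {i : Ordinal.{v}}
    (hi : i < (w.append w').length) (h : i < w.length) :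
    (w.append w').letter ⟨i, hi⟩ = w.letter ⟨i, h⟩ :=
  dif_pos h

theorem append_letter_add (w w' : TransfiniteWord.{u, v} X) {i : Ordinal.{v}}
    (hi : w.length + i < (w.append w').length) (h : i < w'.length) :
    (w.append w').letter ⟨w.length + i, hi⟩ = w'.letter ⟨i, h⟩ := by
  simp [append]

@[simp]
theorem append_nil (w : TransfiniteWord.{u, v} X) : w.append nil = w :=
  ext_letter (by simp) fun _ hi hi' => append_letter_of_lt _ _ hi hi'

@[simp]
theorem nil_append (w : TransfiniteWord.{u, v} X) : nil.append w = w := by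
  refine ext_letter (by simp) fun i hi hi' => ?_
  rw [← append_letter_add nil w (i := i) (by simpa using hi') hi']
  congr
  simp

theorem append_assoc (u v w : TransfiniteWord.{u, v} X) :
    (u.append v).append w = u.append (v.append w) := by
  refine ext_letter (by simp [add_assoc]) fun i hi hi' => ?_
  rcases lt_or_ge i u.length with h | h
  · exact ((append_letter_of_lt (u.append v) w hi (h.trans_le le_self_add)).trans
      (append_letter_of_lt u v _ h)).trans (append_letter_of_lt u (v.append w) hi' h).symm
  · obtain ⟨i, rfl⟩ := exists_add_of_le h
    have h₁ : i < v.length + w.length := by simpa using hi'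
    refine Eq.trans ?_ (append_letter_add u (v.append w) hi' h₁).symm
    rcases lt_or_ge i v.length with h | h
    · exact ((append_letter_of_lt (u.append v) w hi (add_lt_add_right h _)).trans
        (append_letter_add u v _ h)).trans (append_letter_of_lt v w h₁ h).symm
    · obtain ⟨i, rfl⟩ := exists_add_of_le h
      have h₂ : i < w.length := by simpa using h₁
      have e : u.length + (v.length + i) = (u.append v).length + i := (add_assoc _ _ _).symm
      refine Eq.trans ?_ (append_letter_add v w h₁ h₂).symm
      exact (congrArg ((u.append v).append w).letter (Subtype.ext e)).trans
        (append_letter_add (u.append v) w (e ▸ hi) h₂)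

theorem append_inj_of_length {u u' w w' : TransfiniteWord.{u, v} X}
    (h : u.append w = u'.append w') (hl : u.length = u'.length) : u = u' ∧ w = w' := by
  have key {a b : TransfiniteWord.{u, v} X} (hab : a = b) (i : Ordinal.{v}) (hi : i < a.length)
      (hi' : i < b.length) : a.letter ⟨i, hi⟩ = b.letter ⟨i, hi'⟩ := by
    subst hab; rfl
  have hl' : w.length = w'.length := by
    have := congrArg length h
    simpa [hl] using this
  refine ⟨ext_letter hl fun i hi hi' => ?_, ext_letter hl' fun i hi hi' => ?_⟩
  · have := key h i (hi.trans_le le_self_add) (hi'.trans_le le_self_add)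
    rwa [append_letter_of_lt _ _ _ hi, append_letter_of_lt _ _ _ hi'] at this
  · have := key h (u.length + i) (by simpa using hi) (by simpa [hl] using hi')
    rw [append_letter_add _ _ _ hi] at this
    rw [this, ← append_letter_add u' w' (by simpa using hi') hi']
    congr 2
    rw [hl]

theorem exists_eq_append (w : TransfiniteWord.{u, v} X) {a : Ordinal.{v}} (ha : a ≤ w.length) :
    ∃ u v : TransfiniteWord.{u, v} X, w = u.append v ∧ u.length = a := by
  obtain ⟨b, hb⟩ := exists_add_of_le ha
  refine ⟨⟨a, fun i => w.letter ⟨i.1, lt_of_lt_of_le i.2 ha⟩⟩,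
    ⟨b, fun i => w.letter ⟨a + i.1, Set.mem_Iio.2 (by rw [hb]; exact add_lt_add_right i.2 a)⟩⟩,
    ext_letter hb fun i hi hi' => ?_, rfl⟩
  rcases lt_or_ge i a with h | h
  · rw [append_letter_of_lt _ _ _ h]
  · obtain ⟨i, rfl⟩ := exists_add_of_le h
    have h : i < b := by rw [hb] at hi; simpa using hi
    exact (append_letter_add ⟨a, _⟩ ⟨b, _⟩ hi' h).symm

theorem exists_of_append_eq_append {u p v q : TransfiniteWord.{u, v} X}
    (h : u.append p = v.append q) (hl : u.length ≤ v.length) :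
    ∃ w, v = u.append w ∧ p = w.append q := by
  obtain ⟨u', w, rfl, hu⟩ := exists_eq_append v hl
  rw [append_assoc] at h
  obtain ⟨rfl, rfl⟩ := append_inj_of_length h hu.symm
  exact ⟨w, rfl, rfl⟩

theorem forall_letter_append {F : Set X} {u w : TransfiniteWord.{u, v} X} :
    (∀ i, (u.append w).letter i ∈ F) ↔ (∀ i, u.letter i ∈ F) ∧ ∀ i, w.letter i ∈ F := by
  constructor
  · refine fun h => ⟨fun ⟨i, hi⟩ => ?_, fun ⟨i, hi⟩ => ?_⟩
    · rw [← append_letter_of_lt u w (lt_of_lt_of_le hi le_self_add) hi]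
      exact h _
    · rw [← append_letter_add u w (by simpa using hi) hi]
      exact h _
  · rintro ⟨hu, hw⟩ ⟨i, hi⟩
    rcases lt_or_ge i u.length with h | h
    · exact (append_letter_of_lt u w hi h).symm ▸ hu _
    · obtain ⟨i, rfl⟩ := exists_add_of_le h
      exact (append_letter_add u w hi (by simpa using hi)).symm ▸ hw _

/-! ### Sets of words -/

theorem append_mem_powLT {F : Set X} {a : Ordinal.{v}} {u w : TransfiniteWord.{u, v} X} :
    u.append w ∈ powLT F a ↔
      u.length + w.length < a ∧ (∀ i, u.letter i ∈ F) ∧ ∀ i, w.letter i ∈ F := by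
  rw [powLT, Set.mem_ofPred_eq, forall_letter_append, length_append]

theorem nil_mem_powLT (F : Set X) {a : Ordinal.{v}} (ha : 0 < a) :
    nil ∈ powLT F a :=
  ⟨ha, fun i => absurd i.2 (not_lt_bot (α := Ordinal.{v}))⟩

theorem powLT_subset_powLT {F G : Set X} {a b : Ordinal.{v}} (h : F ⊆ G) (hab : a ≤ b) :
    powLT F a ⊆ powLT G b :=
  fun _ hw => ⟨hw.1.trans_le hab, fun i => h (hw.2 i)⟩

theorem powLT_inter_powLT (F G : Set X) (a b : Ordinal.{v}) :
    powLT F a ∩ powLT G b = powLT (F ∩ G) (min a b) := by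
  ext w
  simp only [powLT, Set.mem_inter_iff, Set.mem_ofPred_eq, lt_min_iff, forall_and]
  tauto

/-- The constant word of given length. -/
def const (x : X) (a : Ordinal.{v}) : TransfiniteWord.{u, v} X :=
  ⟨a, fun _ => x⟩

theorem powLT_subset_powLT_iff {F G : Set X} {a b : Ordinal.{v}} (hF : F.Nonempty) (ha : 1 < a) :
    powLT F a ⊆ powLT G b ↔ F ⊆ G ∧ a ≤ b := by
  refine ⟨fun h => ⟨fun x hx => ?_, ?_⟩, fun h => powLT_subset_powLT h.1 h.2⟩
  · have : const x 1 ∈ powLT F a := ⟨ha, fun _ => hx⟩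
    exact (h this).2 ⟨0, zero_lt_one (α := Ordinal.{v})⟩
  · obtain ⟨x, hx⟩ := hF
    by_contra! hb
    have : const x b ∈ powLT F a := ⟨hb, fun _ => hx⟩
    exact (h this).1.false

theorem setAppend_mono {A A' B B' : Set (TransfiniteWord.{u, v} X)} (h : A ⊆ A') (h' : B ⊆ B') :
    setAppend A B ⊆ setAppend A' B' :=
  Set.image2_subset h h'

theorem append_mem_setAppend {A B : Set (TransfiniteWord.{u, v} X)}
    {u w : TransfiniteWord.{u, v} X} (hu : u ∈ A) (hw : w ∈ B) : u.append w ∈ setAppend A B :=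
  Set.mem_image2_of_mem hu hw

theorem setAppend_assoc (A B C : Set (TransfiniteWord.{u, v} X)) :
    setAppend (setAppend A B) C = setAppend A (setAppend B C) :=
  Set.image2_assoc append_assoc

@[simp]
theorem singleton_nil_setAppend (A : Set (TransfiniteWord.{u, v} X)) :
    setAppend {nil} A = A := by
  simp [setAppend]

@[simp]
theorem setAppend_singleton_nil (A : Set (TransfiniteWord.{u, v} X)) :
    setAppend A {nil} = A := by
  simp [setAppend]

theorem union_setAppend (A B C : Set (TransfiniteWord.{u, v} X)) :
    setAppend (A ∪ B) C = setAppend A C ∪ setAppend B C :=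
  Set.image2_union_left

theorem setAppend_union (A B C : Set (TransfiniteWord.{u, v} X)) :
    setAppend A (B ∪ C) = setAppend A B ∪ setAppend A C :=
  Set.image2_union_right

theorem subset_setAppend_right {A B : Set (TransfiniteWord.{u, v} X)} (h : nil ∈ A) :
    B ⊆ setAppend A B :=
  fun w hw => nil_append w ▸ append_mem_setAppend h hw

theorem subset_setAppend_left {A B : Set (TransfiniteWord.{u, v} X)} (h : nil ∈ B) :
    A ⊆ setAppend A B :=
  fun w hw => append_nil w ▸ append_mem_setAppend hw h

/-- Words of length less than the core of a bound are absorbed. -/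
theorem setAppend_powLT_core (F : Set X) {a : Ordinal.{v}} (ha : a.IsBound) :
    setAppend (powLT F a.core) (powLT F a) ⊆ powLT F a := by
  rintro _ ⟨u, hu, w, hw, rfl⟩
  exact append_mem_powLT.2 ⟨ha.add_lt hu.1 hw.1, hu.2, hw.2⟩

theorem powLT_eq_singleton_nil {F : Set X} {a : Ordinal.{v}} (ha : 0 < a)
    (h : F = ∅ ∨ a = 1) : powLT F a = {nil} := by
  refine Set.Subset.antisymm (fun w hw => eq_nil_of_length ?_)
    (Set.singleton_subset_iff.2 (nil_mem_powLT F ha))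
  rcases h with rfl | rfl
  · by_contra h
    exact hw.2 ⟨0, pos_iff_ne_zero.2 h⟩
  · exact Order.lt_one_iff.1 hw.1

/-- Such words have at most one letter. This is why factors with bound `2` can be required to have
an irreducible base. -/
theorem powLT_union_two (F G : Set X) :
    powLT (F ∪ G) 2 = (powLT F 2 ∪ powLT G 2 : Set (TransfiniteWord.{u, v} X)) := by
  refine Set.Subset.antisymm (fun w hw => ?_) (Set.union_subset
    (powLT_subset_powLT Set.subset_union_left le_rfl)
    (powLT_subset_powLT Set.subset_union_right le_rfl))
  have hl : w.length ≤ 1 := by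
    rw [← Order.lt_add_one_iff, one_add_one_eq_two]
    exact hw.1
  by_cases h : 0 < w.length
  · have key (i : Set.Iio w.length) : i = ⟨0, h⟩ :=
      Subtype.ext (Order.lt_one_iff.1 (lt_of_lt_of_le i.2 hl))
    exact (hw.2 ⟨0, h⟩).imp (fun h' => ⟨hw.1, fun i => key i ▸ h'⟩)
      fun h' => ⟨hw.1, fun i => key i ▸ h'⟩
  · exact .inl ⟨hw.1, fun i => absurd (bot_le.trans_lt (Set.mem_Iio.1 i.2)) h⟩

theorem powLT_add (F : Set X) (a : Ordinal.{v}) {b : Ordinal.{v}} (hb : 0 < b) :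
    powLT F (a + b) = setAppend (powLT F (a + 1)) (powLT F b) := by
  refine Set.Subset.antisymm (fun w hw => ?_) ?_
  · rcases lt_or_ge a w.length with h | h
    · obtain ⟨u, v, rfl, rfl⟩ := exists_eq_append w h.le
      rw [append_mem_powLT] at hw
      exact append_mem_setAppend ⟨lt_add_one _, hw.2.1⟩ ⟨by simpa using hw.1, hw.2.2⟩
    · exact subset_setAppend_left (nil_mem_powLT F hb) ⟨Order.lt_add_one_iff.2 h, hw.2⟩
  · rintro _ ⟨u, hu, w, hw, rfl⟩
    exact append_mem_powLT.2 ⟨add_lt_add_of_le_of_lt (Order.lt_add_one_iff.1 hu.1) hw.1, hu.2, hw.2⟩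

/-- Half of the description of the intersection of two products. -/
theorem append_mem_inter {F G : Set X} {a b : Ordinal.{v}} (hb : b.IsBound)
    {P Q : Set (TransfiniteWord.{u, v} X)} {u p v q : TransfiniteWord.{u, v} X}
    (hu : u ∈ powLT F a) (hp : p ∈ P) (hv : v ∈ powLT G b) (hq : q ∈ Q)
    (h : u.append p = v.append q) (hl : u.length ≤ v.length) :
    u.append p ∈ setAppend (powLT (F ∩ G) (min a b.core)) (P ∩ setAppend (powLT G b) Q) ∪
      setAppend (powLT (F ∩ G) (min a b)) (P ∩ Q) := by
  obtain ⟨w, rfl, rfl⟩ := exists_of_append_eq_append h hl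
  rw [append_mem_powLT] at hv
  rcases eq_or_ne w.length 0 with hw | hw
  · right
    obtain rfl := eq_nil_of_length hw
    rw [nil_append] at hp ⊢
    rw [← powLT_inter_powLT]
    exact append_mem_setAppend ⟨hu, by simpa using hv.1, hv.2.1⟩ ⟨hp, hq⟩
  · left
    rw [← powLT_inter_powLT]
    exact append_mem_setAppend
      ⟨hu, hb.lt_core_of_add_lt hv.1 (pos_iff_ne_zero.2 hw), hv.2.1⟩
      ⟨hp, append_mem_setAppend ⟨le_add_self.trans_lt hv.1, hv.2.2⟩ hq⟩

/-- The three terms correspond to which of the two first pieces is shorter, or neither. A strictly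
shorter piece lies below the core of the other bound, and absorption by the core gives the reverse
inclusions. -/
theorem setAppend_powLT_inter_setAppend_powLT {F G : Set X} {a b : Ordinal.{v}} (ha : a.IsBound)
    (hb : b.IsBound) (P Q : Set (TransfiniteWord.{u, v} X)) :
    setAppend (powLT F a) P ∩ setAppend (powLT G b) Q =
      setAppend (powLT (F ∩ G) (min a b.core)) (P ∩ setAppend (powLT G b) Q) ∪
      setAppend (powLT (F ∩ G) (min a b)) (P ∩ Q) ∪
      setAppend (powLT (F ∩ G) (min a.core b)) (setAppend (powLT F a) P ∩ Q) := by
  refine Set.Subset.antisymm ?_ (Set.union_subset (Set.union_subset ?_ ?_) ?_)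
  · rintro _ ⟨⟨u, hu, p, hp, rfl⟩, v, hv, q, hq, h⟩
    rcases le_total u.length v.length with hl | hl
    · exact .inl (append_mem_inter hb hu hp hv hq h.symm hl)
    · have := append_mem_inter ha hv hq hu hp h hl
      rw [h, Set.inter_comm G, min_comm b, min_comm b, Set.inter_comm Q, Set.inter_comm Q] at this
      exact this.elim .inr fun h => .inl (.inr h)
  · rw [← powLT_inter_powLT]
    refine Set.subset_inter (setAppend_mono Set.inter_subset_left Set.inter_subset_left) ?_
    refine (setAppend_mono Set.inter_subset_right Set.inter_subset_right).trans ?_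
    rw [← setAppend_assoc]
    exact setAppend_mono (setAppend_powLT_core G hb) le_rfl
  · rw [← powLT_inter_powLT]
    exact Set.subset_inter (setAppend_mono Set.inter_subset_left Set.inter_subset_left)
      (setAppend_mono Set.inter_subset_right Set.inter_subset_right)
  · rw [← powLT_inter_powLT]
    refine Set.subset_inter ?_ (setAppend_mono Set.inter_subset_right Set.inter_subset_right)
    refine (setAppend_mono Set.inter_subset_left Set.inter_subset_left).trans ?_
    rw [← setAppend_assoc]
    exact setAppend_mono (setAppend_powLT_core F ha) le_rfl

variable [TopologicalSpace X]

@[simp]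
theorem closedProduct_nil :
    closedProduct ([] : List (Closeds X × Ordinal.{v})) = {nil} :=
  rfl

@[simp]
theorem closedProduct_cons (p : Closeds X × Ordinal.{v}) (L : List (Closeds X × Ordinal.{v})) :
    closedProduct (p :: L) = setAppend (powLT (p.1 : Set X) p.2) (closedProduct L) :=
  rfl

theorem closedProduct_append (L L' : List (Closeds X × Ordinal.{v})) :
    closedProduct (L ++ L') = setAppend (closedProduct L) (closedProduct L') := by
  induction L with
  | nil => simp
  | cons p L ih => rw [List.cons_append, closedProduct_cons, closedProduct_cons, ih, setAppend_assoc]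

theorem nil_mem_closedProduct {L : List (Closeds X × Ordinal.{v})} (h : ∀ p ∈ L, 0 < p.2) :
    nil ∈ closedProduct L := by
  induction L with
  | nil => rfl
  | cons p L ih =>
    rw [List.forall_mem_cons] at h
    exact subset_setAppend_left (ih h.2) (nil_mem_powLT _ h.1)

theorem mem_closedProduct_of_append_mem {L : List (Closeds X × Ordinal.{v})}
    {u w : TransfiniteWord.{u, v} X} (h : u.append w ∈ closedProduct L)
    (hL : ∀ p ∈ L, 0 < p.2) : w ∈ closedProduct L := by
  induction L generalizing u w with
  | nil =>
    have := congrArg length (Set.mem_singleton_iff.1 h)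
    exact eq_nil_of_length (nonpos_iff_eq_zero.1 (le_add_self.trans this.le))
  | cons p L ih =>
    rw [List.forall_mem_cons] at hL
    obtain ⟨a, ha, b, hb, hab⟩ := h
    rcases le_total u.length a.length with hl | hl
    · obtain ⟨c, rfl, rfl⟩ := exists_of_append_eq_append hab.symm hl
      rw [append_mem_powLT] at ha
      exact append_mem_setAppend ⟨le_add_self.trans_lt ha.1, ha.2.2⟩ hb
    · obtain ⟨c, rfl, rfl⟩ := exists_of_append_eq_append hab hl
      exact subset_setAppend_right (nil_mem_powLT _ hL.1) (ih hb hL.2)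

end TransfiniteWord

namespace TransfiniteWord

variable {X : Type u} [TopologicalSpace X]

/-! ### Finite unions of products -/

/-- The factors `F^{<a}` of which irreducible closed sets of words are products. -/
def IsFactor (p : Closeds X × Ordinal.{v}) : Prop :=
  (p.1 : Set X).Nonempty ∧ p.2.IsBound ∧ p.2 ≠ 1 ∧ (p.2 = 2 → IsIrreducible (p.1 : Set X))

namespace IsFactor

variable {p : Closeds X × Ordinal.{v}}

theorem two_le (h : IsFactor p) : 2 ≤ p.2 :=
  h.2.1.two_le h.2.2.1

theorem one_lt (h : IsFactor p) : 1 < p.2 :=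
  lt_of_lt_of_le (by rw [← one_add_one_eq_two]; exact lt_add_one _) h.two_le

theorem pos (h : IsFactor p) : 0 < p.2 :=
  h.2.1.pos

end IsFactor

/-- Finite unions of products of factors. -/
inductive IsRegular : Set (TransfiniteWord.{u, v} X) → Prop
  | empty : IsRegular ∅
  | prod (L : List (Closeds X × Ordinal.{v})) (hL : ∀ p ∈ L, IsFactor p) :
      IsRegular (closedProduct L)
  | union {A B : Set (TransfiniteWord.{u, v} X)} (hA : IsRegular A) (hB : IsRegular B) :
      IsRegular (A ∪ B)

theorem IsRegular.singleton_nil : IsRegular ({nil} : Set (TransfiniteWord.{u, v} X)) :=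
  .prod [] (by simp)

theorem IsRegular.setAppend {A B : Set (TransfiniteWord.{u, v} X)} (hA : IsRegular A)
    (hB : IsRegular B) : IsRegular (setAppend A B) := by
  induction hA with
  | empty => simpa [TransfiniteWord.setAppend] using IsRegular.empty
  | union _ _ ih ih' =>
    rw [union_setAppend]
    exact ih.union ih'
  | prod L hL =>
    induction hB with
    | empty => simpa [TransfiniteWord.setAppend] using IsRegular.empty
    | union _ _ ih ih' =>
      rw [setAppend_union]
      exact ih.union ih'
    | prod L' hL' =>
      rw [← closedProduct_append]
      exact .prod _ fun p hp => (List.mem_append.1 hp).elim (hL p) (hL' p)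

variable [NoetherianSpace X]

theorem IsRegular.powLT_two (F : Closeds X) :
    IsRegular (powLT (F : Set X) 2 : Set (TransfiniteWord.{u, v} X)) := by
  obtain ⟨S, hfin, hirr, rfl⟩ := NoetherianSpace.exists_finite_set_closeds_irreducible F
  induction S, hfin using Set.Finite.induction_on with
  | empty =>
    rw [sSup_empty, powLT_eq_singleton_nil two_pos (.inl Closeds.coe_bot)]
    exact .singleton_nil
  | @insert C S _ _ ih =>
    rw [sSup_insert, Closeds.coe_sup, powLT_union_two]
    refine .union ?_ (ih fun C h => hirr C (Set.mem_insert_of_mem _ h))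
    have hC := hirr C (Set.mem_insert _ _)
    have : IsFactor (C, (2 : Ordinal.{v})) :=
      ⟨hC.nonempty, ⟨0, .inr (by simp [one_add_one_eq_two])⟩, by simp, fun _ => hC⟩
    simpa using IsRegular.prod [(C, (2 : Ordinal.{v}))] (by simpa using this)

theorem IsRegular.powLT_of_isBound (F : Closeds X) {a : Ordinal.{v}} (ha : a.IsBound) :
    IsRegular (powLT (F : Set X) a) := by
  by_cases h : (F : Set X) = ∅ ∨ a = 1
  · rw [powLT_eq_singleton_nil ha.pos h]
    exact .singleton_nil
  · push Not at h
    rcases eq_or_ne a 2 with rfl | h₂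
    · exact .powLT_two F
    · have : IsFactor (F, a) := ⟨h.1, ha, h.2, fun h => absurd h h₂⟩
      simpa using IsRegular.prod [(F, a)] (by simpa using this)

/-- Peel off the leading power of `ω` from `a`: by `powLT_add` it contributes a factor with bound `ω
^ b + 1`, and the remainder is smaller. -/
theorem IsRegular.powLT (F : Closeds X) (a : Ordinal.{v}) :
    IsRegular (powLT (F : Set X) a) := by
  induction a using WellFoundedLT.induction with
  | ind a ih =>
    rcases eq_or_ne a 0 with rfl | ha
    · convert IsRegular.empty
      exact Set.eq_empty_of_forall_notMem fun w hw => not_lt_bot (α := Ordinal.{v}) hw.1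
    · have hlt := Ordinal.sub_omega0_opow_log_lt ha
      have heq := Ordinal.add_sub_cancel_of_le (Ordinal.opow_log_le_self Ordinal.omega0 ha)
      generalize a - _ = b at hlt heq
      rcases eq_or_ne b 0 with rfl | hb
      · rw [add_zero] at heq
        exact .powLT_of_isBound F ⟨_, .inl heq.symm⟩
      · rw [← heq, powLT_add _ _ (pos_iff_ne_zero.2 hb)]
        exact .setAppend (.powLT_of_isBound F ⟨_, .inr rfl⟩) (ih b hlt)

theorem IsRegular.closedProduct (L : List (Closeds X × Ordinal.{v})) :
    IsRegular (closedProduct L) := by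
  induction L with
  | nil => exact .singleton_nil
  | cons p L ih => exact .setAppend (.powLT p.1 p.2) ih

/-- Double induction on the lists: each of the three terms of the intersection formula drops a first
factor from at least one side. -/
theorem IsRegular.closedProduct_inter {L L' : List (Closeds X × Ordinal.{v})}
    (hL : ∀ p ∈ L, p.2.IsBound) (hL' : ∀ p ∈ L', p.2.IsBound) :
    IsRegular (TransfiniteWord.closedProduct L ∩ TransfiniteWord.closedProduct L') := by
  induction L generalizing L' with
  | nil =>
    convert IsRegular.singleton_nil
    exact Set.inter_eq_left.2 (Set.singleton_subset_iff.2
      (nil_mem_closedProduct fun p hp => (hL' p hp).pos))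
  | cons p L ih =>
    rw [List.forall_mem_cons] at hL
    induction L' with
    | nil =>
      convert IsRegular.singleton_nil
      exact Set.inter_eq_right.2 (Set.singleton_subset_iff.2
        (nil_mem_closedProduct (List.forall_mem_cons.2 ⟨hL.1.pos, fun p hp => (hL.2 p hp).pos⟩)))
    | cons q L' ih' =>
      have hL'' := List.forall_mem_cons.1 hL'
      rw [closedProduct_cons p, closedProduct_cons q,
        setAppend_powLT_inter_setAppend_powLT hL.1 hL''.1, ← closedProduct_cons,
        ← closedProduct_cons, ← Closeds.coe_inf]
      exact .union (.union (.setAppend (.powLT _ _) (ih hL.2 hL'))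
        (.setAppend (.powLT _ _) (ih hL.2 hL''.2))) (.setAppend (.powLT _ _) (ih' hL''.2))

theorem IsRegular.inter {A B : Set (TransfiniteWord.{u, v} X)} (hA : IsRegular A)
    (hB : IsRegular B) : IsRegular (A ∩ B) := by
  induction hA with
  | empty =>
    rw [Set.empty_inter]
    exact .empty
  | union _ _ ih ih' =>
    rw [Set.union_inter_distrib_right]
    exact ih.union ih'
  | prod L hL =>
    induction hB with
    | empty =>
      rw [Set.inter_empty]
      exact .empty
    | union _ _ ih ih' =>
      rw [Set.inter_union_distrib_left]
      exact ih.union ih'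
    | prod L' hL' =>
      exact .closedProduct_inter (fun p hp => (hL p hp).2.1) fun p hp => (hL' p hp).2.1

variable (X) in
/-- The lattice of finite unions of products. -/
def regularSublattice : Sublattice (Set (TransfiniteWord.{u, v} X)) where
  carrier := {A | IsRegular A}
  supClosed' := fun _ hA _ hB => IsRegular.union hA hB
  infClosed' := fun _ hA _ hB => IsRegular.inter hA hB

end TransfiniteWord

namespace TransfiniteWord

variable {X : Type u} [TopologicalSpace X]

/-! ### Inclusions between products -/

theorem powLT_subset_closedProduct {L : List (Closeds X × Ordinal.{v})}
    (hL : ∀ p ∈ L, IsFactor p) {e : Closeds X × Ordinal.{v}} (he : e ∈ L) :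
    powLT (e.1 : Set X) e.2 ⊆ closedProduct L := by
  induction L with
  | nil => simp at he
  | cons p L ih =>
    rw [List.forall_mem_cons] at hL
    rcases List.mem_cons.1 he with rfl | he
    · exact subset_setAppend_left (nil_mem_closedProduct fun p hp => (hL.2 p hp).pos)
    · exact (ih hL.2 he).trans (subset_setAppend_right (nil_mem_powLT _ hL.1.pos))

/-! ### Generic words and residues -/

/-- The words `p` such that, for some factor `f` that contains `e`, what `p` has to satisfy after
a word of `e` was read into `f` holds. -/
def Residue (e : Set (TransfiniteWord.{u, v} X)) :
    List (Closeds X × Ordinal.{v}) → TransfiniteWord.{u, v} X → Prop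
  | [], _ => False
  | f :: L, p => (e ⊆ powLT (f.1 : Set X) f.2 ∧ (p ∈ closedProduct L ∨
      e ⊆ powLT (f.1 : Set X) f.2.core ∧ p ∈ closedProduct (f :: L))) ∨ Residue e L p

theorem Residue.mem {e : Set (TransfiniteWord.{u, v} X)} {L : List (Closeds X × Ordinal.{v})}
    (hL : ∀ f ∈ L, f.2.IsBound) {p : TransfiniteWord.{u, v} X} (h : Residue e L p) :
    p ∈ closedProduct L := by
  induction L with
  | nil => exact h.elim
  | cons f L ih =>
    rw [List.forall_mem_cons] at hL
    have hsub : closedProduct L ⊆ closedProduct (f :: L) :=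
      subset_setAppend_right (nil_mem_powLT _ hL.1.pos)
    rcases h with ⟨-, h | h⟩ | h
    · exact hsub h
    · exact h.2
    · exact hsub (ih hL.2 h)

/-- Whether `e` lies in `f^{<a}` or in its core part does not depend on the word `p`, so at the
first factor containing `e` the same alternative serves all of `A`. -/
theorem setAppend_subset_of_forall_residue {e A : Set (TransfiniteWord.{u, v} X)}
    {L : List (Closeds X × Ordinal.{v})} (hL : ∀ f ∈ L, f.2.IsBound) (hA : A.Nonempty)
    (h : ∀ p ∈ A, Residue e L p) : setAppend e A ⊆ closedProduct L := by
  induction L with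
  | nil => exact (h _ hA.some_mem).elim
  | cons f L ih =>
    have hL' := List.forall_mem_cons.1 hL
    by_cases he : e ⊆ powLT (f.1 : Set X) f.2
    · by_cases he' : e ⊆ powLT (f.1 : Set X) f.2.core
      · refine (setAppend_mono he' fun p hp => (h p hp).mem hL).trans ?_
        rw [closedProduct_cons, ← setAppend_assoc]
        exact setAppend_mono (setAppend_powLT_core _ hL'.1) le_rfl
      · refine setAppend_mono he fun p hp => ?_
        rcases h p hp with ⟨-, h | h⟩ | h
        · exact h
        · exact absurd h.1 he'
        · exact h.mem hL'.2
    · refine (ih hL'.2 fun p hp => ?_).trans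
        (subset_setAppend_right (nil_mem_powLT _ hL'.1.pos))
      exact (h p hp).resolve_left fun h => he h.1

/-- Concatenate, for each factor of `L` not containing `e`, a word of `e` outside that factor; the
power `ω ^ c` leaves room for this. Such a factor cannot consume its witness, so the rest of the
generic word is left for the later factors. -/
theorem exists_generic_opow {G : Set X} (hG : G.Nonempty) {c : Ordinal.{v}} (hc : c ≠ 0)
    {L : List (Closeds X × Ordinal.{v})} (hL : ∀ f ∈ L, f.2.IsBound) :
    ∃ w ∈ powLT G (Ordinal.omega0 ^ c), ∀ p : TransfiniteWord.{u, v} X,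
      w.append p ∈ closedProduct L → Residue (powLT G (Ordinal.omega0 ^ c)) L p := by
  have h1 : 1 < Ordinal.omega0 ^ c := Ordinal.one_lt_opow.2 ⟨Ordinal.one_lt_omega0, hc⟩
  induction L with
  | nil =>
    obtain ⟨x, hx⟩ := hG
    refine ⟨const x 1, ⟨h1, fun _ => hx⟩, fun p hp => ?_⟩
    have : 1 + p.length = 0 := congrArg length (Set.mem_singleton_iff.1 hp)
    exact absurd (le_self_add.trans this.le) (not_le.2 zero_lt_one)
  | cons f L ih =>
    rw [List.forall_mem_cons] at hL
    obtain ⟨w, hw, h⟩ := ih hL.2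
    by_cases he : powLT G (Ordinal.omega0 ^ c) ⊆ powLT (f.1 : Set X) f.2
    · refine ⟨w, hw, fun p hp => .inl ⟨he, .inr ⟨?_, ?_⟩⟩⟩
      · rw [powLT_subset_powLT_iff hG h1] at he ⊢
        -- Since `ω ^ c` is a limit, being at most the bound `f.2` already means being at most its
        -- core.
        refine ⟨he.1, le_of_forall_lt fun l hl => hL.1.lt_core_of_add_lt (lt_of_lt_of_le ?_ he.2)
          (zero_lt_one' Ordinal.{v})⟩
        exact Ordinal.isPrincipal_add_omega0_opow c hl h1
      · exact mem_closedProduct_of_append_mem hp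
          (List.forall_mem_cons.2 ⟨hL.1.pos, fun q hq => (hL.2 q hq).pos⟩)
    · obtain ⟨w', hw', hf⟩ := Set.not_subset.1 he
      refine ⟨w'.append w, append_mem_powLT.2
        ⟨Ordinal.isPrincipal_add_omega0_opow c hw'.1 hw.1, hw'.2, hw.2⟩, fun p hp => .inr ?_⟩
      obtain ⟨a, ha, b, hb, hab⟩ := hp
      rw [append_assoc] at hab
      rcases le_total w'.length a.length with hl | hl
      · obtain ⟨d, rfl, -⟩ := exists_of_append_eq_append hab.symm hl
        rw [append_mem_powLT] at ha
        exact absurd ⟨le_self_add.trans_lt ha.1, ha.2.1⟩ hf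
      · obtain ⟨d, rfl, rfl⟩ := exists_of_append_eq_append hab hl
        exact h p (mem_closedProduct_of_append_mem hb fun q hq => (hL.2 q hq).pos)

/-- A factor either reads all of `w`, and then contains `G` since otherwise a letter escapes, or
stops early. In the latter case the unread tail still has length `ω ^ c` by indecomposability and
still escapes cofinally. -/
theorem residue_of_append_mem {G : Set X} {c : Ordinal.{v}}
    {L : List (Closeds X × Ordinal.{v})} (hL : ∀ f ∈ L, f.2.IsBound)
    {w p : TransfiniteWord.{u, v} X} (hw : w.length = Ordinal.omega0 ^ c)
    (hcof : ∀ f ∈ L, G ⊆ f.1 ∨ ∀ l < Ordinal.omega0 ^ c, ∃ i, l ≤ i ∧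
      ∃ hi : i < w.length, w.letter ⟨i, hi⟩ ∉ f.1)
    (h : w.append p ∈ closedProduct L) : Residue (powLT G (Ordinal.omega0 ^ c + 1)) L p := by
  have hpos : 0 < Ordinal.omega0 ^ c := Ordinal.opow_pos c Ordinal.omega0_pos
  induction L generalizing w with
  | nil =>
    have : w.length + p.length = 0 := congrArg length (Set.mem_singleton_iff.1 h)
    rw [hw] at this
    exact absurd (le_self_add.trans this.le) (not_le.2 hpos)
  | cons f L ih =>
    rw [List.forall_mem_cons] at hL hcof
    obtain ⟨a, ha, b, hb, hab⟩ := h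
    rcases le_or_gt w.length a.length with hl | hl
    · obtain ⟨d, rfl, rfl⟩ := exists_of_append_eq_append hab.symm hl
      obtain ⟨hlen, hwF, hdF⟩ := append_mem_powLT.1 ha
      rw [hw] at hlen
      have hGf : G ⊆ f.1 := hcof.1.resolve_right fun h => by
        obtain ⟨i, -, hi, h⟩ := h 0 hpos
        exact h (hwF _)
      refine .inl ⟨powLT_subset_powLT hGf (Order.add_one_le_of_lt (le_self_add.trans_lt hlen)), ?_⟩
      rcases eq_or_ne d.length 0 with hd | hd
      · left
        rwa [eq_nil_of_length hd, nil_append]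
      · right
        exact ⟨powLT_subset_powLT hGf (Order.add_one_le_of_lt
          (hL.1.lt_core_of_add_lt hlen (pos_iff_ne_zero.2 hd))),
          append_mem_setAppend ⟨le_add_self.trans_lt hlen, hdF⟩ hb⟩
    · obtain ⟨d, rfl, rfl⟩ := exists_of_append_eq_append hab hl.le
      right
      rw [length_append] at hw
      have hac : a.length < Ordinal.omega0 ^ c := by rwa [length_append, hw] at hl
      have hd : d.length = Ordinal.omega0 ^ c := by
        refine le_antisymm (le_add_self.trans hw.le) ?_
        by_contra! hd
        exact (Ordinal.isPrincipal_add_omega0_opow c hac hd).ne hw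
      refine ih hL.2 hd (fun f' hf' => (hcof.2 f' hf').imp_right fun h l hl => ?_) hb
      obtain ⟨i, hli, hi, h⟩ := h (a.length + l) (Ordinal.isPrincipal_add_omega0_opow c hac hl)
      obtain ⟨i, rfl⟩ := exists_add_of_le (le_self_add.trans hli)
      have hi' : i < d.length := by simpa using hi
      exact ⟨i, by simpa using hli, hi', (append_letter_add a d hi hi') ▸ h⟩

theorem exists_cofinal_word {G : Set X} (hG : G.Nonempty) {c : Ordinal.{v}}
    (hirr : c = 0 → IsIrreducible G) (L : List (Closeds X)) :
    ∃ w : TransfiniteWord.{u, v} X, w.length = Ordinal.omega0 ^ c ∧ (∀ i, w.letter i ∈ G) ∧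
      ∀ F ∈ L, G ⊆ F ∨ ∀ l < Ordinal.omega0 ^ c, ∃ i, l ≤ i ∧
        ∃ hi : i < w.length, w.letter ⟨i, hi⟩ ∉ F := by
  classical
  rcases eq_or_ne c 0 with rfl | hc
  · have : ∃ x ∈ G, ∀ F ∈ L, G ⊆ F ∨ x ∉ F := by
      by_contra! h
      -- The finitely many closed sets not containing `G` would cover the irreducible `G`.
      let T : Finset (Set X) := (L.map fun F : Closeds X => (F : Set X)).toFinset.filter (¬G ⊆ ·)
      obtain ⟨F, hF, hGF⟩ := isIrreducible_iff_sUnion_isClosed.1 (hirr rfl) T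
        (by
          intro F hF
          obtain ⟨F, -, rfl⟩ := List.mem_map.1 (List.mem_toFinset.1 (Finset.mem_filter.1 hF).1)
          exact F.isClosed)
        (by
          intro x hx
          obtain ⟨F, hF, hGF, hxF⟩ := h x hx
          exact ⟨F, Finset.mem_coe.2 (Finset.mem_filter.2
            ⟨List.mem_toFinset.2 (List.mem_map_of_mem hF), hGF⟩), hxF⟩)
      exact (Finset.mem_filter.1 hF).2 hGF
    obtain ⟨x, hx, h⟩ := this
    refine ⟨const x 1, by simp [const], fun _ => hx, fun F hF => (h F hF).imp_right ?_⟩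
    intro h l hl
    exact ⟨0, by simpa using hl, zero_lt_one' Ordinal.{v}, h⟩
  · have hy (F : Closeds X) : ∃ x ∈ G, G ⊆ F ∨ x ∉ F := by
      by_cases h : G ⊆ F
      · exact ⟨hG.some, hG.some_mem, .inl h⟩
      · obtain ⟨x, hx, h⟩ := Set.not_subset.1 h
        exact ⟨x, hx, .inr h⟩
    choose y hyG hy using hy
    have hω : Ordinal.omega0 ≤ Ordinal.omega0 ^ c :=
      Ordinal.left_le_opow _ (pos_iff_ne_zero.2 hc)
    -- The letters cycle with period `k` through points escaping the members of `L`. The extra slot,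
    -- filled with `⊤`, keeps `k` positive for empty `L`.
    have hk : ((L.length + 1 : ℕ) : Ordinal.{v}) ≠ 0 := Nat.cast_ne_zero.2 (Nat.succ_ne_zero _)
    generalize hkL : L.length + 1 = k at hk
    have hN (i : Ordinal.{v}) : ∃ n : ℕ, i % (k : Ordinal.{v}) = n :=
      Ordinal.lt_omega0.1 ((Ordinal.mod_lt i hk).trans (Ordinal.natCast_lt_omega0 k))
    choose N hN using hN
    refine ⟨⟨Ordinal.omega0 ^ c, fun i => y (L.getD (N i) ⊤)⟩, rfl, fun i => hyG _,
      fun F hF => (hy F).imp_right fun h l hl => ?_⟩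
    obtain ⟨n, hn, rfl⟩ := List.getElem_of_mem hF
    -- Multiplying on the left by the finite `k` fixes `ω ^ c`, as `ω` divides it; so the position
    -- `k * l + n`, congruent to `n`, stays within the word.
    have hi : k * l + n < Ordinal.omega0 ^ c := by
      refine Ordinal.isPrincipal_add_omega0_opow c ?_ ((Ordinal.natCast_lt_omega0 n).trans_le hω)
      have hdvd : Ordinal.omega0 ∣ Ordinal.omega0 ^ c := by
        conv_lhs => rw [← Ordinal.opow_one Ordinal.omega0]
        exact Ordinal.opow_dvd_opow _ (Order.one_le_iff_pos.2 (pos_iff_ne_zero.2 hc))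
      rw [← Ordinal.mul_omega0_dvd (pos_iff_ne_zero.2 hk) (Ordinal.natCast_lt_omega0 k) hdvd]
      exact mul_lt_mul_of_pos_left hl (pos_iff_ne_zero.2 hk)
    refine ⟨k * l + n, ?_, hi, ?_⟩
    · exact (Ordinal.le_mul_right l (pos_iff_ne_zero.2 hk)).trans le_self_add
    · have : N (k * l + n) = n := by
        have := hN (k * l + n)
        rw [Ordinal.mul_add_mod_self, Ordinal.mod_eq_of_lt (by exact_mod_cast (by omega))] at this
        exact_mod_cast this.symm
      simpa [this, hn] using h

theorem exists_generic {e : Closeds X × Ordinal.{v}} (he : IsFactor e)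
    {L : List (Closeds X × Ordinal.{v})} (hL : ∀ f ∈ L, f.2.IsBound) :
    ∃ w ∈ powLT (e.1 : Set X) e.2, ∀ p : TransfiniteWord.{u, v} X,
      w.append p ∈ closedProduct L → Residue (powLT (e.1 : Set X) e.2) L p := by
  obtain ⟨G, a⟩ := e
  obtain ⟨hG, ⟨c, rfl | rfl⟩, h₁, h₂⟩ := he
  · exact exists_generic_opow hG (fun h => h₁ (by simp [h])) hL
  · obtain ⟨w, hw, hwG, hcof⟩ := exists_cofinal_word (c := c) hG
      (fun h => h₂ (by simp [h, one_add_one_eq_two])) (L.map Prod.fst)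
    refine ⟨w, ⟨by rw [hw]; exact lt_add_one _, hwG⟩, fun p hp =>
      residue_of_append_mem hL hw (fun f hf => hcof f.1 (List.mem_map_of_mem hf)) hp⟩

/-- Three outcomes for a generic word of `e`: it skips `f`, it uses `f` up, or it is absorbed by
`f`, which stays available. -/
theorem closedProduct_cons_subset {e f : Closeds X × Ordinal.{v}}
    {A L : List (Closeds X × Ordinal.{v})} (he : IsFactor e) (hA : ∀ p ∈ A, IsFactor p)
    (hL : ∀ p ∈ f :: L, p.2.IsBound) (h : closedProduct (e :: A) ⊆ closedProduct (f :: L)) :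
    closedProduct (e :: A) ⊆ closedProduct L ∨
      powLT (e.1 : Set X) e.2 ⊆ powLT (f.1 : Set X) f.2 ∧ (closedProduct A ⊆ closedProduct L ∨
        powLT (e.1 : Set X) e.2 ⊆ powLT (f.1 : Set X) f.2.core ∧
          closedProduct A ⊆ closedProduct (f :: L)) := by
  obtain ⟨w, hw, hgen⟩ := exists_generic he hL
  have key (p) (hp : p ∈ closedProduct A) := hgen p (h (append_mem_setAppend hw hp))
  have hL' := (List.forall_mem_cons.1 hL).2
  by_cases he : powLT (e.1 : Set X) e.2 ⊆ powLT (f.1 : Set X) f.2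
  · refine .inr ⟨he, ?_⟩
    by_cases he' : powLT (e.1 : Set X) e.2 ⊆ powLT (f.1 : Set X) f.2.core
    · exact .inr ⟨he', fun p hp => (key p hp).mem hL⟩
    · refine .inl fun p hp => ?_
      rcases key p hp with ⟨-, h | h⟩ | h
      · exact h
      · exact absurd h.1 he'
      · exact h.mem hL'
  · exact .inl (setAppend_subset_of_forall_residue hL'
      ⟨nil, nil_mem_closedProduct fun p hp => (hA p hp).pos⟩
      fun p hp => (key p hp).resolve_left fun h => he h.1)

/-- `D` consists of the factors absorbed by `f`, possibly followed by one that uses it up. -/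
theorem exists_eq_append_of_closedProduct_subset {f : Closeds X × Ordinal.{v}}
    {A L : List (Closeds X × Ordinal.{v})} (hA : ∀ p ∈ A, IsFactor p)
    (hL : ∀ p ∈ f :: L, p.2.IsBound) (h : closedProduct A ⊆ closedProduct (f :: L)) :
    ∃ D E, A = D ++ E ∧ closedProduct D ⊆ powLT (f.1 : Set X) f.2 ∧
      closedProduct E ⊆ closedProduct L := by
  have hL' := List.forall_mem_cons.1 hL
  have hnil : nil ∈ closedProduct L := nil_mem_closedProduct fun p hp => (hL'.2 p hp).pos
  have hnil' : nil ∈ powLT (f.1 : Set X) f.2 := nil_mem_powLT _ hL'.1.pos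
  induction A with
  | nil => exact ⟨[], [], rfl, Set.singleton_subset_iff.2 hnil', Set.singleton_subset_iff.2 hnil⟩
  | cons e A ih =>
    have hA' := List.forall_mem_cons.1 hA
    rcases closedProduct_cons_subset hA'.1 hA'.2 hL h with h | ⟨he, h | ⟨he', h⟩⟩
    · exact ⟨[], e :: A, rfl, Set.singleton_subset_iff.2 hnil', h⟩
    · exact ⟨[e], A, rfl, by simpa using he, h⟩
    · obtain ⟨D, E, rfl, hD, hE⟩ := ih hA'.2 h
      exact ⟨e :: D, E, rfl, (setAppend_mono he' hD).trans (setAppend_powLT_core _ hL'.1), hE⟩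

end TransfiniteWord

namespace TransfiniteWord

variable {X : Type u} [TopologicalSpace X] [NoetherianSpace X]

/-! ### Weights of products -/

open Classical in
/-- The weight of a factor `F^{<a}`. -/
def factorWeight (p : Closeds X × Ordinal.{v}) : Ordinal.{max u (v + 1)} :=
  if p.2 = 2 then Ordinal.lift.{v + 1} (wfRank p.1)
  else Ordinal.omega0 ^ Ordinal.adjust (Ordinal.naturalSum (Ordinal.lift.{v + 1} (wfRank p.1))
    (Ordinal.lift.{u} (Ordinal.flt p.2)))

/-- The weight of a product: the natural sum of the weights of its factors. -/
def weight (L : List (Closeds X × Ordinal.{v})) : Ordinal.{max u (v + 1)} :=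
  L.foldr (fun p o => Ordinal.naturalSum (factorWeight p) o) 0

theorem weight_cons (p : Closeds X × Ordinal.{v}) (L : List (Closeds X × Ordinal.{v})) :
    weight (p :: L) = Ordinal.naturalSum (factorWeight p) (weight L) :=
  rfl

theorem weight_singleton (p : Closeds X × Ordinal.{v}) : weight [p] = factorWeight p :=
  Ordinal.naturalSum_zero _

theorem weight_append (L L' : List (Closeds X × Ordinal.{v})) :
    weight (L ++ L') = Ordinal.naturalSum (weight L) (weight L') := by
  induction L with
  | nil => exact (Ordinal.zero_naturalSum _).symm
  | cons p L ih => rw [List.cons_append, weight_cons, weight_cons, ih, Ordinal.naturalSum_assoc]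

theorem factorWeight_le (p : Closeds X × Ordinal.{v}) :
    factorWeight p ≤ Ordinal.omega0 ^ Ordinal.adjust
      (Ordinal.naturalSum (Ordinal.lift.{v + 1} (wfRank p.1))
        (Ordinal.lift.{u} (Ordinal.flt p.2))) := by
  unfold factorWeight
  split_ifs
  · exact (Ordinal.le_naturalSum_left _ _).trans (Ordinal.lt_opow_adjust _).le
  · exact le_rfl

theorem factorWeight_pos {p : Closeds X × Ordinal.{v}} (hp : (p.1 : Set X).Nonempty) :
    0 < factorWeight p := by
  unfold factorWeight
  split_ifs
  · have h0 : Ordinal.lift.{v + 1} (wfRank (⊥ : Closeds X)) = 0 := by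
      rw [wfRank_bot, Ordinal.lift_zero]
    rw [← h0, Ordinal.lift_lt]
    refine wfRank_lt_wfRank (bot_lt_iff_ne_bot.2 fun h => ?_)
    rw [h] at hp
    simp at hp
  · exact Ordinal.opow_pos _ Ordinal.omega0_pos

theorem factorWeight_lt_or_eq {e f : Closeds X × Ordinal.{v}} (he : IsFactor e) (hf : f.2.IsBound)
    (hf₁ : f.2 ≠ 1) (h : powLT (e.1 : Set X) e.2 ⊆ powLT (f.1 : Set X) f.2) :
    factorWeight e < factorWeight f ∨ e = f := by
  obtain ⟨hF, ha⟩ := (powLT_subset_powLT_iff he.1 he.one_lt).1 h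
  replace hF : e.1 ≤ f.1 := hF
  have hrank : Ordinal.lift.{v + 1} (wfRank e.1) ≤ Ordinal.lift.{v + 1} (wfRank f.1) :=
    Ordinal.lift_le.2 (WellFoundedLT.rank_strictMono.monotone hF)
  have hrank' (h : e.1 ≠ f.1) :
      Ordinal.lift.{v + 1} (wfRank e.1) < Ordinal.lift.{v + 1} (wfRank f.1) :=
    Ordinal.lift_lt.2 (wfRank_lt_wfRank (lt_of_le_of_ne hF h))
  by_cases hf₂ : f.2 = 2
  · have he₂ : e.2 = 2 := le_antisymm (ha.trans hf₂.le) he.two_le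
    by_cases hef : e.1 = f.1
    · exact .inr (Prod.ext hef (he₂.trans hf₂.symm))
    · left
      rw [factorWeight, factorWeight, if_pos he₂, if_pos hf₂]
      exact hrank' hef
  · by_cases he₂ : e.2 = 2
    · left
      rw [factorWeight, factorWeight, if_pos he₂, if_neg hf₂]
      exact hrank.trans_lt ((Ordinal.le_naturalSum_left _ _).trans_lt (Ordinal.lt_opow_adjust _))
    · by_cases hef : e = f
      · exact .inr hef
      · left
        rw [factorWeight, factorWeight, if_neg he₂, if_neg hf₂,
          Ordinal.opow_lt_opow_iff_right Ordinal.one_lt_omega0]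
        refine Ordinal.adjust_strictMono ?_
        rcases ha.eq_or_lt with ha | ha
        · rw [ha]
          exact Ordinal.naturalSum_lt_of_lt_of_le (hrank' fun h => hef (Prod.ext h ha)) le_rfl
        · exact Ordinal.naturalSum_lt_of_le_of_lt hrank (Ordinal.lift_lt.2
            (Ordinal.flt_lt_flt (he.2.1.isProperBound he.2.2.1 he₂) (hf.isProperBound hf₁ hf₂) ha))

/-- Here `f` need not be a factor: for `f.2 = 2` its base may be reducible, as needed for the whole
space. -/
theorem exists_weight_le_factorWeight {f : Closeds X × Ordinal.{v}} (hf : f.2.IsBound)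
    (hf₁ : f.2 ≠ 1) (hF : (f.1 : Set X).Nonempty) {D : List (Closeds X × Ordinal.{v})}
    (hD : ∀ p ∈ D, IsFactor p) (h : closedProduct D ⊆ powLT (f.1 : Set X) f.2) :
    ∃ D', (∀ p ∈ D', IsFactor p) ∧ closedProduct D' = closedProduct D ∧
      weight D' ≤ factorWeight f ∧
        (closedProduct D = powLT (f.1 : Set X) f.2 ∨ weight D' < factorWeight f) := by
  have key (e) (he : e ∈ D) : factorWeight e < factorWeight f ∨ e = f :=
    factorWeight_lt_or_eq (hD e he) hf hf₁ ((powLT_subset_closedProduct hD he).trans h)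
  by_cases hf₂ : f.2 = 2
  · refine ⟨D, hD, rfl, ?_⟩
    match D, hD, h, key with
    | [], _, _, _ => exact ⟨zero_le, .inr (factorWeight_pos hF)⟩
    | [e], _, _, key =>
      rw [weight_singleton]
      rcases key e (by simp) with h | rfl
      · exact ⟨h.le, .inr h⟩
      · exact ⟨le_rfl, .inl (by simp)⟩
    -- Two non-trivial factors would produce a word of length two.
    | e :: e' :: D, hD, h, _ =>
      rw [List.forall_mem_cons, List.forall_mem_cons] at hD
      obtain ⟨x, hx⟩ := hD.1.1
      obtain ⟨y, hy⟩ := hD.2.1.1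
      have hx : const x 1 ∈ powLT (e.1 : Set X) e.2 := ⟨hD.1.one_lt, fun _ => hx⟩
      have hy : const y 1 ∈ powLT (e'.1 : Set X) e'.2 := ⟨hD.2.1.one_lt, fun _ => hy⟩
      have := h (append_mem_setAppend hx (append_mem_setAppend hy
        (nil_mem_closedProduct fun p hp => (hD.2.2 p hp).pos)))
      rw [append_nil] at this
      have := (append_mem_powLT.1 this).1
      rw [hf₂] at this
      simp [const, one_add_one_eq_two] at this
  · have hfa : IsFactor f := ⟨hF, hf, hf₁, fun h => absurd h hf₂⟩
    -- If `f` occurs in `D`, the product equals `f` as a set but may weigh more; `[f]` is then the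
    -- economical description. Otherwise all weights lie below a power of `ω`, and so does their
    -- natural sum.
    by_cases hfD : f ∈ D
    · have heq := h.antisymm (powLT_subset_closedProduct hD hfD)
      exact ⟨[f], by simpa using hfa, by simp [heq], (weight_singleton f).le, .inl heq⟩
    · have hlt : weight D < factorWeight f := by
        replace key (e) (he : e ∈ D) : factorWeight e < factorWeight f :=
          (key e he).resolve_right fun h => hfD (h ▸ he)
        clear hfD h hD
        induction D with
        | nil => exact factorWeight_pos hF
        | cons e D ih =>
          rw [List.forall_mem_cons] at key
          have ih := ih key.2
          have he := key.1
          rw [factorWeight.eq_1 f, if_neg hf₂] at ih he ⊢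
          exact Ordinal.naturalSum_lt_opow he ih
      exact ⟨D, hD, rfl, hlt.le, .inr hlt⟩

theorem exists_weight_le_weight {A B : List (Closeds X × Ordinal.{v})} (hA : ∀ p ∈ A, IsFactor p)
    (hB : ∀ p ∈ B, IsFactor p) (h : closedProduct A ⊆ closedProduct B) :
    ∃ A', (∀ p ∈ A', IsFactor p) ∧ closedProduct A' = closedProduct A ∧ weight A' ≤ weight B ∧
      (closedProduct A = closedProduct B ∨ weight A' < weight B) := by
  induction B generalizing A with
  | nil =>
    have := h.antisymm (Set.singleton_subset_iff.2
      (nil_mem_closedProduct fun p hp => (hA p hp).pos))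
    exact ⟨[], by simp, this.symm, le_rfl, .inl this⟩
  | cons f B ih =>
    have hB' := List.forall_mem_cons.1 hB
    obtain ⟨D, E, rfl, hD, hE⟩ :=
      exists_eq_append_of_closedProduct_subset hA (fun p hp => (hB p hp).2.1) h
    obtain ⟨D', hD'A, hD', hle, hD''⟩ := exists_weight_le_factorWeight hB'.1.2.1 hB'.1.2.2.1
      hB'.1.1 (fun p hp => hA p (List.mem_append_left E hp)) hD
    obtain ⟨E', hE'A, hE', hle', hE''⟩ :=
      ih (fun p hp => hA p (List.mem_append_right D hp)) hB'.2 hE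
    refine ⟨D' ++ E', fun p hp => (List.mem_append.1 hp).elim (hD'A p) (hE'A p), ?_, ?_, ?_⟩
    · rw [closedProduct_append, closedProduct_append, hD', hE']
    · rw [weight_append, weight_cons]
      exact Ordinal.naturalSum_le_naturalSum hle hle'
    · rw [weight_append, weight_cons, closedProduct_append, closedProduct_cons]
      rcases hD'' with hD'' | hD''
      · rcases hE'' with hE'' | hE''
        · left
          rw [hD'', hE'']
        · exact .inr (Ordinal.naturalSum_lt_of_le_of_lt hle hE'')
      · exact .inr (Ordinal.naturalSum_lt_of_lt_of_le hD'' hle')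

/-! ### Minimal weights and well-foundedness -/

/-- The least weight of a product of factors that describes a set of words. -/
def minWeight (S : Set (TransfiniteWord.{u, v} X)) : Ordinal.{max u (v + 1)} :=
  sInf (weight '' {A : List (Closeds X × Ordinal.{v}) | (∀ p ∈ A, IsFactor p) ∧ closedProduct A = S})

theorem minWeight_le {A : List (Closeds X × Ordinal.{v})} (hA : ∀ p ∈ A, IsFactor p) :
    minWeight (closedProduct A) ≤ weight A :=
  csInf_le' (Set.mem_image_of_mem _ ⟨hA, rfl⟩)

/-- Compare with a description of the larger set that attains its minimal weight. -/
theorem minWeight_lt_minWeight {A B : List (Closeds X × Ordinal.{v})}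
    (hA : ∀ p ∈ A, IsFactor p) (hB : ∀ p ∈ B, IsFactor p)
    (h : closedProduct A ⊂ closedProduct B) :
    minWeight (closedProduct A) < minWeight (closedProduct B) := by
  obtain ⟨B', ⟨hB', heq⟩, hw⟩ : minWeight (closedProduct B) ∈ weight ''
      {C : List (Closeds X × Ordinal.{v}) |
        (∀ p ∈ C, IsFactor p) ∧ closedProduct C = closedProduct B} :=
    csInf_mem ⟨_, Set.mem_image_of_mem _ ⟨hB, rfl⟩⟩
  obtain ⟨A', hA', heq', -, h'⟩ := exists_weight_le_weight hA hB' (heq ▸ h.1)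
  rw [← hw, ← heq']
  exact (minWeight_le hA').trans_lt (h'.resolve_left fun h' => h.ne (h'.trans heq))

instance : WellFoundedLT (regularSublattice.{u, v} X) where
  wf := by
    -- Accessibility passes from products to finite unions. The predicate `P` restricts attention to
    -- products inside a given one, so that an induction hypothesis on weights applies.
    have of_isRegular (A : Set (TransfiniteWord.{u, v} X)) (hA : IsRegular A)
        (P : Set (TransfiniteWord.{u, v} X) → Prop) (hP : ∀ S T, P (S ∪ T) → P S ∧ P T)
        (h : ∀ (L) (hL : ∀ p ∈ L, IsFactor p), P (closedProduct L) →
          Acc (· < ·) (⟨_, .prod L hL⟩ : regularSublattice.{u, v} X)) (hPA : P A) :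
        Acc (· < ·) (⟨A, hA⟩ : regularSublattice.{u, v} X) := by
      induction hA with
      | empty => exact Acc.intro _ fun S hS => absurd hS.1 fun _ => hS.2 (Set.empty_subset _)
      | prod L hL => exact h L hL hPA
      | union hS hT ihS ihT => exact acc_lt_sup (ihS (hP _ _ hPA).1) (ihT (hP _ _ hPA).2)
    have prod (o : Ordinal) (L : List (Closeds X × Ordinal.{v})) (hL : ∀ p ∈ L, IsFactor p)
        (ho : minWeight (closedProduct L) = o) :
        Acc (· < ·) (⟨_, .prod L hL⟩ : regularSublattice.{u, v} X) := by
      induction o using WellFoundedLT.induction generalizing L with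
      | ind o ih =>
        refine Acc.intro _ fun S hS => of_isRegular S.1 S.2 (· ⊂ closedProduct L)
          (fun S T h => ⟨Set.subset_union_left.trans_ssubset h,
            Set.subset_union_right.trans_ssubset h⟩) (fun L' hL' h => ?_) hS
        exact ih _ (ho ▸ minWeight_lt_minWeight hL' hL h) L' hL' rfl
    exact ⟨fun S => of_isRegular S.1 S.2 (fun _ => True) (by simp)
      (fun L hL _ => prod _ L hL rfl) trivial⟩

end TransfiniteWord

/-! ### The space of words -/

namespace WordsLT

open TransfiniteWord

variable {X : Type u}

/-- The underlying word. -/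
def toWord {a : Ordinal.{v}} (w : WordsLT X a) : TransfiniteWord.{u, v} X :=
  w.1

theorem toWord_injective {a : Ordinal.{v}} : Function.Injective (toWord (X := X) (a := a)) :=
  Subtype.val_injective

theorem range_toWord {a : Ordinal.{v}} :
    Set.range (toWord (X := X) (a := a)) = powLT Set.univ a :=
  Subtype.range_val

variable [TopologicalSpace X]

theorem isClosed_preimage_closedProduct (a : Ordinal.{v}) (L : List (Closeds X × Ordinal.{v})) :
    IsClosed (toWord (X := X) (a := a) ⁻¹' closedProduct L) :=
  isOpen_compl_iff.1 (isOpen_generateFrom_of_mem ⟨L, rfl⟩)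

theorem isClosed_preimage (a : Ordinal.{v}) {A : Set (TransfiniteWord.{u, v} X)}
    (hA : IsRegular A) : IsClosed (toWord (X := X) (a := a) ⁻¹' A) := by
  induction hA with
  | empty => exact isClosed_empty
  | prod L _ => exact isClosed_preimage_closedProduct a L
  | union _ _ ih ih' => exact ih.union ih'

variable [NoetherianSpace X]

/-- The sets with regular image are the closed sets of a topology in which all generating sets are
closed, so it refines the given one. -/
theorem isRegular_image {a : Ordinal.{v}} {C : Set (WordsLT X a)} (hC : IsClosed C) :
    IsRegular (toWord '' C) := by
  let T : TopologicalSpace (WordsLT X a) :=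
    TopologicalSpace.ofClosed {C | IsRegular (toWord '' C)}
    (by
      rw [Set.mem_ofPred_eq, Set.image_empty]
      exact .empty)
    (by
      intro 𝒜 h𝒜
      let S : Set (regularSublattice.{u, v} X) := {M | ∃ C, M.1 = toWord '' C ∧ ⋂₀ 𝒜 ⊆ C}
      have huniv : IsRegular (toWord (X := X) (a := a) '' Set.univ) := by
        rw [Set.image_univ, range_toWord]
        exact .powLT ⊤ a
      have hS : S.Nonempty := ⟨⟨_, huniv⟩, Set.univ, rfl, Set.subset_univ _⟩
      -- For arbitrary intersections, a minimal regular set containing the intersection lies in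
      -- every member `B`, as cutting it with `B` cannot shrink it.
      obtain ⟨⟨M, hM⟩, ⟨C, rfl : M = _, hC⟩, hmin⟩ := exists_minimal_of_wellFoundedLT (· ∈ S) hS
      rw [Set.mem_ofPred_eq, hC.antisymm (Set.subset_sInter fun B hB => ?_)]
      · exact hM
      have hCB : IsRegular (toWord '' (C ∩ B)) := by
        rw [Set.image_inter toWord_injective]
        exact hM.inter (h𝒜 hB)
      have := hmin (y := ⟨_, hCB⟩) ⟨_, rfl, Set.subset_inter hC (Set.sInter_subset_of_mem hB)⟩
        (Set.image_mono Set.inter_subset_left)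
      exact ((Set.image_subset_image_iff toWord_injective).1 this).trans Set.inter_subset_right)
    (by
      intro A hA B hB
      rw [Set.mem_ofPred_eq, Set.image_union]
      exact .union hA hB)
  have hT : T ≤ instTopologicalSpaceWordsLT X a := by
    refine le_generateFrom ?_
    rintro _ ⟨L, rfl⟩
    change IsRegular (toWord '' (toWord ⁻¹' closedProduct L)ᶜᶜ)
    rw [compl_compl, Set.image_preimage_eq_inter_range, range_toWord]
    exact (IsRegular.closedProduct L).inter (.powLT ⊤ a)
  have hC' : IsRegular (toWord '' Cᶜᶜ) := hT _ hC.isOpen_compl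
  rwa [compl_compl] at hC'

instance (a : Ordinal.{v}) : NoetherianSpace (WordsLT X a) := by
  refine ((noetherianSpace_TFAE (WordsLT X a)).out 0 1).2 ?_
  let f : Closeds (WordsLT X a) → regularSublattice.{u, v} X := fun C =>
    ⟨toWord '' (C : Set (WordsLT X a)), isRegular_image C.isClosed⟩
  have hf : StrictMono f := fun C D h =>
    toWord_injective.image_strictMono (SetLike.coe_ssubset_coe.2 h)
  exact hf.wellFoundedLT

/-- An irreducible closed set inside a finite union of products lies in one of them; apply this to
its own description as such a union. -/
theorem exists_closedProduct {a : Ordinal.{v}} (C : IrreducibleCloseds (WordsLT X a)) :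
    ∃ A : List (Closeds X × Ordinal.{v}), (∀ p ∈ A, IsFactor p) ∧
      toWord '' (C : Set (WordsLT X a)) = closedProduct A := by
  have key (S : Set (TransfiniteWord.{u, v} X)) (hS : IsRegular S)
      (hCS : toWord '' (C : Set (WordsLT X a)) ⊆ S) :
      ∃ A : List (Closeds X × Ordinal.{v}), (∀ p ∈ A, IsFactor p) ∧ closedProduct A ⊆ S ∧
        toWord '' (C : Set (WordsLT X a)) ⊆ closedProduct A := by
    induction hS with
    | empty =>
      exact absurd (C.isIrreducible.nonempty.image _)
        (Set.not_nonempty_iff_eq_empty.2 (Set.subset_empty_iff.1 hCS))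
    | prod L hL => exact ⟨L, hL, le_rfl, hCS⟩
    | @union S T hS hT ihS ihT =>
      rcases isPreirreducible_iff_isClosed_union_isClosed.1 C.isIrreducible.2 _ _
        (isClosed_preimage a hS) (isClosed_preimage a hT)
        ((Set.image_subset_iff (f := toWord)).1 hCS) with h | h
      · obtain ⟨A, hA, hAS, hCA⟩ := ihS (Set.image_subset_iff.2 h)
        exact ⟨A, hA, hAS.trans Set.subset_union_left, hCA⟩
      · obtain ⟨A, hA, hAS, hCA⟩ := ihT (Set.image_subset_iff.2 h)
        exact ⟨A, hA, hAS.trans Set.subset_union_right, hCA⟩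
  obtain ⟨A, hA, hAC, hCA⟩ := key _ (isRegular_image C.isClosed) le_rfl
  exact ⟨A, hA, hCA.antisymm hAC⟩

theorem strictMono_minWeight (a : Ordinal.{v}) :
    StrictMono fun C : IrreducibleCloseds (WordsLT X a) =>
      minWeight (toWord '' (C : Set (WordsLT X a))) := by
  intro C C' h
  obtain ⟨A, hA, hCA⟩ := exists_closedProduct C
  obtain ⟨A', hA', hCA'⟩ := exists_closedProduct C'
  simp only [hCA, hCA']
  refine minWeight_lt_minWeight hA hA' ?_
  rw [← hCA, ← hCA', Set.ssubset_def, Set.image_subset_image_iff toWord_injective,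
    Set.image_subset_image_iff toWord_injective]
  exact h

theorem minWeight_le_and {a : Ordinal.{v}} (ha : a.IsBound)
    (C : IrreducibleCloseds (WordsLT X a)) :
    minWeight (toWord '' (C : Set (WordsLT X a))) ≤ factorWeight ((⊤ : Closeds X), a) ∧
      ((C : Set (WordsLT X a)) ≠ Set.univ →
        minWeight (toWord '' (C : Set (WordsLT X a))) < factorWeight ((⊤ : Closeds X), a)) := by
  obtain ⟨A, hA, hCA⟩ := exists_closedProduct C
  have hsub : closedProduct A ⊆ powLT (Set.univ : Set X) a := by
    rw [← hCA, ← range_toWord]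
    exact Set.image_subset_range _ _
  -- In these degenerate cases only the empty word exists; its weight is zero.
  by_cases h : (Set.univ : Set X) = ∅ ∨ a = 1
  · rw [powLT_eq_singleton_nil ha.pos h] at hsub
    have heq : closedProduct A = {nil} := hsub.antisymm (Set.singleton_subset_iff.2
      (nil_mem_closedProduct fun p hp => (hA p hp).pos))
    refine ⟨?_, fun hC => absurd ?_ hC⟩
    · rw [hCA, heq]
      exact (minWeight_le (A := []) (by simp)).trans zero_le
    · apply toWord_injective.image_injective
      rw [hCA, heq, Set.image_univ, range_toWord, powLT_eq_singleton_nil ha.pos h]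
  · push Not at h
    obtain ⟨A', hA', heq, hle, h'⟩ := exists_weight_le_factorWeight (f := ((⊤ : Closeds X), a))
      ha h.2 h.1 hA hsub
    rw [hCA, ← heq]
    refine ⟨(minWeight_le hA').trans hle, fun hC => (minWeight_le hA').trans_lt
      (h'.resolve_left fun h' => hC ?_)⟩
    apply toWord_injective.image_injective
    rw [hCA, Set.image_univ, range_toWord]
    exact h'

end WordsLT

end

/-! ### The two bounds -/

theorem mainTheorem3 {X : Type u} [TopologicalSpace X] [TopologicalSpace.NoetherianSpace X]
    (α : Ordinal.{v}) (hα : Ordinal.IsBound α) :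
    ∃ _ : TopologicalSpace.NoetherianSpace (WordsLT X α),
      rsob (WordsLT X α) ≤
        Ordinal.omega0 ^ Ordinal.adjust
          (Ordinal.naturalSum (Ordinal.lift.{v + 1} (stature X))
            (Ordinal.lift.{u} (Ordinal.flt α))) ∧
      stature (WordsLT X α) ≤
        Ordinal.omega0 ^ Ordinal.omega0 ^ Ordinal.adjust
          (Ordinal.naturalSum (Ordinal.lift.{v + 1} (stature X))
            (Ordinal.lift.{u} (Ordinal.flt α))) := by
  -- The base `⊤` has rank `stature X` by definition, so the weight of the whole space is at most
  -- the stated power.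
  have hle := TransfiniteWord.factorWeight_le ((⊤ : TopologicalSpace.Closeds X), α)
  refine ⟨inferInstance, Ordinal.iSup_le fun C => ?_, ?_⟩
  · exact ((wfRank_le_of_strictMono (WordsLT.strictMono_minWeight α) C.1).trans
      (WordsLT.minWeight_le_and hα C.1).1).trans hle
  · exact stature_le_opow (WordsLT.strictMono_minWeight α)
      fun C hC => ((WordsLT.minWeight_le_and hα C).2 hC).trans_le hle
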